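/- Let $d\ge 1$, $1<\alpha_i<2$, $d_{i,\pm}\ge 0$ with $d_{i,+}+d_{i,-}>0$ for $1\le i\le d$, and put $$\mu:=\max_{1\le i\le d}\frac{|d_{i,+}-d_{i,-}|}{d_{i,+}+d_{i,-}}\left|\tan\left(\frac{\alpha_i}{2}\pi\right)\right| .$$ For a box $\prod_i(a_i,b_i)$, a time step $\tau>0$ and $\mathbf n=(n_1,\dots,n_d)$ with all $n_i\ge 1$, let $n=n_1\cdots n_d$, $\nu=1/\tau$, $h_i=(b_i-a_i)/(n_i+1)$, $v_{i,\pm}=d_{i,\pm}/(2h_i^{\alpha_i})$. Let $g_0^{(\alpha)}=1$, $g_k^{(\alpha)}=(1-\frac{\alpha+1}{k})g_{k-1}^{(\alpha)}$, $w_0^{(\alpha)}=\frac{\alpha}{2}g_0^{(\alpha)}$, $w_k^{(\alpha)}=\frac{\alpha}{2}g_k^{(\alpha)}+\frac{2-\alpha}{2}g_{k-1}^{(\alpha)}$ $(k\ge1)$, and let $L_m^{(\alpha)}\in\mathbb R^{m\times m}$ be the Toeplitz matrix with $(i,j)$ entry $-w_{i-j+1}^{(\alpha)}$ if $i-j+1\ge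 0$ and $0$ otherwise. With $W_i=I_{n_1\cdots n_{i-1}}\otimes L_{n_i}^{(\alpha_i)}\otimes I_{n_{i+1}\cdots n_d}$ define $$A_n=\nu I_n+\sum_{i=1}^d\left(v_{i,+}W_i+v_{i,-}W_i^{\top}\right),\qquad Y_n=Y_{n_1}\otimes\cdots\otimes Y_{n_d},$$ where $Y_m$ is the $m\times m$ anti-identity, and $$P_n=\nu I_n+\sum_{i=1}^d (v_{i,+}+v_{i,-})\, I_{n_1\cdots n_{i-1}}\otimes \tau\big(\mathcal H(L_{n_i}^{(\alpha_i)})\big)\otimes I_{n_{i+1}\cdots n_d},$$ where $\mathcal H(Z)=(Z+Z^\top)/2$ and, for a symmetric Toeplitz matrix $T_m$ with first column $(t_1,\dots,t_m)^\top$, $\tau(T_m)=T_m-H_m$ with $H_m$ the Hankel matrix with first column $(t_3,\dots,t_m,0,0)^\top$ and last column $(0,0,t_m,\dots,t_3)^\top$ ($H_m=0$ if $m\le2$). Then there is a constant $\epsilon$, depending only on $d$, $\alpha_i$, $d_{i,\pm}$ (and not on $\mathbf n$, $\tau$, or the box), with $0<\epsilon<\mu$ if $\mu>0$ and $\epsilon=0$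 if $\mu=0$, such that $$\omega:=\sqrt{\frac{2+3\epsilon}{4+3\epsilon}}\in\left[\sqrt{\tfrac12},1\right),\qquad \omega>\sqrt{\tfrac12}\ \text{ if }\mu>0,$$ and such that, for all boxes, all $\tau>0$ and all $\mathbf n$: the matrix $Y_nA_n$ is symmetric, $P_n$ is symmetric positive definite, all (complex) eigenvalues of $P_n^{-1}Y_nA_n$ are real and lie in $\left(-\frac32(1+\epsilon),-\frac12\right)\cup\left(\frac12,\frac32(1+\epsilon)\right)$, and, for every right-hand side $\mathbf b$, every initial guess $\mathbf u^{(0)}$ and every $k\ge0$, MINRES preconditioned by $P_n$ for $Y_nA_n\mathbf x=Y_n\mathbf b$ has residuals satisfying $$\|\mathbf r^{(k)}\|_{P_n}\le 2\,(\omega^2)^{\lfloor k/2\rfloor}\,\|\mathbf r^{(0)}\|_{P_n},\qquad \mathbf r^{(k)}=P_n^{-1}Y_n\mathbf b-P_n^{-1}Y_nA_n\mathbf u^{(k)} .$$ Here $\|\mathbf z\|_{P}=\sqrt{\mathbf z^\top P\mathbf z}=\|P^{1/2}\mathbf z\|_2$, so that $\|\mathbf r^{(k)}\|_{P_n}=\|Y_n\mathbf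 b-Y_nA_n\mathbf u^{(k)}\|_{P_n^{-1}}$, and the $k$-th iterate $\mathbf u^{(k)}$ is the minimizer of $\|Y_n\mathbf b-Y_nA_n\mathbf u\|_{P_n^{-1}}$ over $\mathbf u\in\mathbf u^{(0)}+\operatorname{span}\{(P_n^{-1}Y_nA_n)^j\mathbf r^{(0)}:0\le j<k\}$. -/

import Mathlib

open Matrix

namespace TauMinres

noncomputable section

/-- The Grünwald coefficients `g_k^{(α)}`. -/
def grunwaldCoeff (α : ℝ) : ℕ → ℝ
  | 0 => 1
  | k + 1 => (1 - (α + 1) / ((k : ℝ) + 1)) * grunwaldCoeff α k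

/-- The weighted and shifted Grünwald coefficients `w_k^{(α)}`. -/
def weightedCoeff (α : ℝ) : ℕ → ℝ
  | 0 => α / 2 * grunwaldCoeff α 0
  | k + 1 => α / 2 * grunwaldCoeff α (k + 1) + (2 - α) / 2 * grunwaldCoeff α k

/-- The lower Hessenberg Toeplitz matrix `L_m^{(α)}`, whose `(i, j)` entry is `-w_{i-j+1}` for
`i - j + 1 ≥ 0` and `0` otherwise. -/
def grunwaldMatrix (α : ℝ) (m : ℕ) : Matrix (Fin m) (Fin m) ℝ :=
  Matrix.of fun i j =>
    if (j : ℕ) ≤ (i : ℕ) + 1 then -weightedCoeff α ((i : ℕ) + 1 - (j : ℕ)) else 0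

/-- The anti-identity matrix `Y_m` (indices start at `0`). -/
def antiIdentity (m : ℕ) : Matrix (Fin m) (Fin m) ℝ :=
  Matrix.of fun i j => if (i : ℕ) + (j : ℕ) + 1 = m then 1 else 0

/-- The symmetric part `(Z + Zᵀ) / 2`. -/
def symPart {m : ℕ} (Z : Matrix (Fin m) (Fin m) ℝ) : Matrix (Fin m) (Fin m) ℝ :=
  (1 / 2 : ℝ) • (Z + Zᵀ)

/-- For a symmetric Toeplitz matrix `T` with first column `(t_1, …, t_m)`, the Hankel matrix with
first column `(t_3, …, t_m, 0, 0)` and last column `(0, 0, t_m, …, t_3)`. With indices starting at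
`0`, so that `T s 0 = t_{s+1}`, its antidiagonal `i + j = s` is constant, equal to `t_{s+3}` when
`s + 3 ≤ m`, to `t_{2m-s+1}` when `2m - s + 1 ≤ m`, and to `0` otherwise. -/
def hankelCorrection {m : ℕ} (T : Matrix (Fin m) (Fin m) ℝ) : Matrix (Fin m) (Fin m) ℝ :=
  Matrix.of fun i j =>
    if h : (i : ℕ) + (j : ℕ) + 2 < m then
      T ⟨(i : ℕ) + (j : ℕ) + 2, h⟩ ⟨0, by omega⟩
    else if h : 2 * m - ((i : ℕ) + (j : ℕ)) < m then
      T ⟨2 * m - ((i : ℕ) + (j : ℕ)), h⟩ ⟨0, by omega⟩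
    else 0

/-- The `τ`-matrix approximation of a symmetric Toeplitz matrix. -/
def tauMatrix {m : ℕ} (T : Matrix (Fin m) (Fin m) ℝ) : Matrix (Fin m) (Fin m) ℝ :=
  T - hankelCorrection T

/-- The index set of grid points of a `d`-dimensional grid with `n i` interior points along
direction `i`. It has `n_1 ⋯ n_d` elements. -/
abbrev Grid {d : ℕ} (n : Fin d → ℕ) : Type := (i : Fin d) → Fin (n i)

/-- The Kronecker product `M_1 ⊗ ⋯ ⊗ M_d`, indexed by multi-indices. -/
def kron {d : ℕ} {n : Fin d → ℕ} (M : (i : Fin d) → Matrix (Fin (n i)) (Fin (n i)) ℝ) :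
    Matrix (Grid n) (Grid n) ℝ :=
  Matrix.of fun x y => ∏ i, M i (x i) (y i)

/-- `I_{n_1 ⋯ n_{i-1}} ⊗ L ⊗ I_{n_{i+1} ⋯ n_d}`. -/
def axisMatrix {d : ℕ} (n : Fin d → ℕ) (i : Fin d) (L : Matrix (Fin (n i)) (Fin (n i)) ℝ) :
    Matrix (Grid n) (Grid n) ℝ :=
  kron (Function.update (fun j => (1 : Matrix (Fin (n j)) (Fin (n j)) ℝ)) i L)

/-- `Y_n = Y_{n_1} ⊗ ⋯ ⊗ Y_{n_d}`. -/
def multiAntiIdentity {d : ℕ} (n : Fin d → ℕ) : Matrix (Grid n) (Grid n) ℝ :=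
  kron fun i => antiIdentity (n i)

/-- `D / (2 h^α)`, with step size `h = (b - a) / (m + 1)`: the scaled diffusion coefficient. -/
def scaledCoeff (D α a b : ℝ) (m : ℕ) : ℝ :=
  D / (2 * ((b - a) / ((m : ℝ) + 1)) ^ α)

/-- The coefficient matrix `A_n = ν I_n + ∑ i, (v_{i,+} W_i + v_{i,-} W_iᵀ)`, where
`W_i = I ⊗ L_{n_i}^{(α_i)} ⊗ I`. -/
def systemMatrix {d : ℕ} (ν : ℝ) (α dp dm a b : Fin d → ℝ) (n : Fin d → ℕ) :
    Matrix (Grid n) (Grid n) ℝ :=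
  ν • (1 : Matrix (Grid n) (Grid n) ℝ) +
    ∑ i, (scaledCoeff (dp i) (α i) (a i) (b i) (n i) •
            axisMatrix n i (grunwaldMatrix (α i) (n i)) +
          scaledCoeff (dm i) (α i) (a i) (b i) (n i) •
            (axisMatrix n i (grunwaldMatrix (α i) (n i)))ᵀ)

/-- The multilevel Tau preconditioner
`P_n = ν I_n + ∑ i, (v_{i,+} + v_{i,-}) I ⊗ τ(H(L_{n_i}^{(α_i)})) ⊗ I`. -/
def tauPreconditioner {d : ℕ} (ν : ℝ) (α dp dm a b : Fin d → ℝ) (n : Fin d → ℕ) :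
    Matrix (Grid n) (Grid n) ℝ :=
  ν • (1 : Matrix (Grid n) (Grid n) ℝ) +
    ∑ i, (scaledCoeff (dp i) (α i) (a i) (b i) (n i) +
          scaledCoeff (dm i) (α i) (a i) (b i) (n i)) •
        axisMatrix n i (tauMatrix (symPart (grunwaldMatrix (α i) (n i))))

/-- `max_i |d_{i,+} - d_{i,-}| / (d_{i,+} + d_{i,-}) · |tan(α_i π / 2)|`. -/
def asymmetry {d : ℕ} (α dp dm : Fin d → ℝ) : ℝ :=
  ⨆ i, |dp i - dm i| / (dp i + dm i) * |Real.tan (α i / 2 * Real.pi)|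

/-- `ω = √((2 + 3ε) / (4 + 3ε))`. -/
def rate (ε : ℝ) : ℝ := √((2 + 3 * ε) / (4 + 3 * ε))

section Minres

variable {ι : Type*} [Fintype ι] [DecidableEq ι]

/-- The residual `P⁻¹ c - P⁻¹ M u` of the preconditioned system `P⁻¹ M u = P⁻¹ c`. -/
def precResidual (M P : Matrix ι ι ℝ) (c u : ι → ℝ) : ι → ℝ :=
  P⁻¹ *ᵥ c - (P⁻¹ * M) *ᵥ u

/-- The energy norm `√(zᵀ P z) = ‖P^{1/2} z‖₂`. For `z = P⁻¹ r` it equals `√(rᵀ P⁻¹ r)`, the norm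
of the residual `r = c - M u` that preconditioned MINRES minimizes. -/
def energyNorm (P : Matrix ι ι ℝ) (z : ι → ℝ) : ℝ :=
  √(z ⬝ᵥ (P *ᵥ z))

/-- The Krylov space `span {r, B r, …, B^{k-1} r}`. -/
def krylov (B : Matrix ι ι ℝ) (r : ι → ℝ) (k : ℕ) : Submodule ℝ (ι → ℝ) :=
  Submodule.span ℝ ((fun j : ℕ => (B ^ j) *ᵥ r) '' Set.Iio k)

/-- `u` is the `k`-th iterate of MINRES with preconditioner `P` for the symmetric system `M x = c`
with initial guess `u₀`: it minimizes the residual, in the norm `‖c - M y‖_{P⁻¹}`, over all `y` in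
`u₀ + K_k(P⁻¹ M, P⁻¹ (c - M u₀))`. -/
def IsMinresIterate (M P : Matrix ι ι ℝ) (c u₀ : ι → ℝ) (k : ℕ) (u : ι → ℝ) : Prop :=
  u - u₀ ∈ krylov (P⁻¹ * M) (precResidual M P c u₀) k ∧
    ∀ y : ι → ℝ, y - u₀ ∈ krylov (P⁻¹ * M) (precResidual M P c u₀) k →
      energyNorm P (precResidual M P c u) ≤ energyNorm P (precResidual M P c y)

open scoped MatrixOrder Matrix.Norms.L2Operator in
/-- MINRES iterates exist. -/
theorem exists_isMinresIterate (M P : Matrix ι ι ℝ) (hP : P.PosDef) (c u₀ : ι → ℝ) (k : ℕ) :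
    ∃ u, IsMinresIterate M P c u₀ k u := by
  obtain ⟨B, hB⟩ := CStarAlgebra.nonneg_iff_eq_star_mul_self.mp hP.posSemidef.nonneg
  rw [Matrix.star_eq_conjTranspose] at hB
  have hE : ∀ z : ι → ℝ, energyNorm P z = ‖WithLp.toLp 2 (B *ᵥ z)‖ := by
    intro z
    rw [EuclideanSpace.norm_eq, energyNorm, hB]
    congr 1
    rw [← Matrix.mulVec_mulVec, Matrix.dotProduct_mulVec, Matrix.conjTranspose_eq_transpose_of_trivial,
      Matrix.vecMul_transpose]
    simp [dotProduct, sq]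
  set K := krylov (P⁻¹ * M) (precResidual M P c u₀) k
  let φ : (ι → ℝ) →ₗ[ℝ] EuclideanSpace ℝ ι :=
    (WithLp.linearEquiv 2 ℝ (ι → ℝ)).symm.toLinearMap ∘ₗ (Matrix.mulVecLin (B * (P⁻¹ * M)))
  have hφ : ∀ y, WithLp.toLp 2 (B *ᵥ precResidual M P c (u₀ + y)) =
      WithLp.toLp 2 (B *ᵥ precResidual M P c u₀) - φ y := by
    intro y
    have : φ y = WithLp.toLp 2 ((B * (P⁻¹ * M)) *ᵥ y) := rfl
    rw [this, ← WithLp.toLp_sub]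
    congr 1
    simp only [precResidual, Matrix.mulVec_add, Matrix.mulVec_sub, ← Matrix.mulVec_mulVec]
    abel
  obtain ⟨s, hs, hmin⟩ := Submodule.exists_norm_eq_iInf_of_complete_subspace (K.map φ)
    (Submodule.complete_of_finiteDimensional _) (WithLp.toLp 2 (B *ᵥ precResidual M P c u₀))
  obtain ⟨y, hy, rfl⟩ := hs
  refine ⟨u₀ + y, by simpa using hy, fun z hz => ?_⟩
  have hz' : precResidual M P c z = precResidual M P c (u₀ + (z - u₀)) := by congr 1; abel
  rw [hE, hE, hz', hφ, hφ, hmin]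
  exact ciInf_le ⟨0, by rintro _ ⟨w, rfl⟩; exact norm_nonneg _⟩
    (⟨φ (z - u₀), Submodule.mem_map_of_mem hz⟩ : K.map φ)

end Minres

end

end TauMinres

/-! The constant is `ε = √(1 + μ²) - 1`. It comes from two quadratic form estimates whose constants
involve neither the mesh, nor the time step, nor the box.

Symmetric part. Along one axis let `T` be the symmetric part of `L` and `K` its Hankel correction,
so that the tau matrix is `T - K`. The inequalities `(T - K) / 2 ≤ T ≤ 3 (T - K) / 2` amount to `T +
K ≥ 0` and `T - 3 K ≥ 0`. Both follow from diagonal dominance, since the off-diagonal coefficients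
are nonnegative and decreasing and twice their sum is at most the diagonal
(`tauMatrix_form_bounds`). Summing over grid lines and adding `ν I` yields `P / 2 < A < 3 P / 2` as
forms, strictly because `ν > 0` (`systemMatrix_form_bounds`).

Skew part. `L` is Toeplitz with symbol `-e^{-iθ} w(e^{iθ})`, where `w(z) = (α/2 + (2-α)/2 z)
(1-z)^α`. After rotation by `απ/2` this symbol stays in a half plane; hence the skew part of `L` is
at most `|tan(απ/2)|` times its symmetric part (`grunwaldMatrix_skew_form_le`). Weighting by
`d_{i,±}` turns this into the bound `μ` for `A`.

Eigenvalues. `Y` is an involution commuting with `P`, so `Y A x = l P x` means `A x = l P Y x`.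
Testing with `x` and using Cauchy–Schwarz for `P` gives `|l| > 1/2`. Testing with `Y x` and using
that `A` has norm at most `√(1 + μ²)` in the energy of its symmetric part gives `|l| < 3/2 √(1 +
μ²)` (`eigenvalue_bounds`).

Convergence. Simultaneous diagonalization of `Y A` and `P` reduces MINRES to polynomials with value
`1` at `0` that are small on `[-b, -a] ∪ [a, b]`; a Chebyshev polynomial in `x²` supplies them
(`energyNorm_minres_le`). -/

namespace TauMinres

/-! ### Signs, monotonicity and partial sums of the Grünwald weights. -/

section Coefficients

variable {α : ℝ}

theorem grunwaldCoeff_succ (α : ℝ) (k : ℕ) :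
    grunwaldCoeff α (k + 1) = (1 - (α + 1) / ((k : ℝ) + 1)) * grunwaldCoeff α k := rfl

theorem weightedCoeff_succ (α : ℝ) (k : ℕ) :
    weightedCoeff α (k + 1) =
      α / 2 * grunwaldCoeff α (k + 1) + (2 - α) / 2 * grunwaldCoeff α k := rfl

theorem succ_mul_grunwaldCoeff_succ (α : ℝ) (k : ℕ) :
    ((k : ℝ) + 1) * grunwaldCoeff α (k + 1) = (k - α) * grunwaldCoeff α k := by
  rw [grunwaldCoeff_succ]
  have : (k : ℝ) + 1 ≠ 0 := by positivity
  field_simp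
  ring

theorem grunwaldCoeff_two (α : ℝ) : grunwaldCoeff α 2 = α * (α - 1) / 2 := by
  norm_num [grunwaldCoeff]
  ring

theorem grunwaldCoeff_nonneg (h1 : 1 < α) (h2 : α < 2) (k : ℕ) :
    0 ≤ grunwaldCoeff α (k + 2) := by
  induction k with
  | zero => rw [grunwaldCoeff_two]; nlinarith
  | succ k ih =>
    rw [grunwaldCoeff_succ]
    refine mul_nonneg ?_ ih
    rw [sub_nonneg, div_le_one (by positivity)]
    push_cast
    linarith [(Nat.cast_nonneg k : (0 : ℝ) ≤ k)]

theorem grunwaldCoeff_succ_le (h1 : 1 < α) (h2 : α < 2) (k : ℕ) :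
    grunwaldCoeff α (k + 3) ≤ grunwaldCoeff α (k + 2) := by
  rw [grunwaldCoeff_succ α (k + 2)]
  have h : 0 ≤ (α + 1) / (((k + 2 : ℕ) : ℝ) + 1) := by positivity
  nlinarith [grunwaldCoeff_nonneg h1 h2 k]

/-- The recurrence makes the sum telescope, so the sign of a partial sum is read off from a single
coefficient. -/
theorem alpha_mul_sum_grunwaldCoeff (α : ℝ) (m : ℕ) :
    α * ∑ k ∈ Finset.range (m + 1), grunwaldCoeff α k =
      -(((m : ℝ) + 1) * grunwaldCoeff α (m + 1)) := by
  induction m with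
  | zero => simp [grunwaldCoeff]
  | succ m ih =>
    rw [Finset.sum_range_succ, mul_add, ih, succ_mul_grunwaldCoeff_succ α (m + 1)]
    push_cast
    ring

theorem sum_grunwaldCoeff_nonpos (h1 : 1 < α) (h2 : α < 2) (m : ℕ) :
    ∑ k ∈ Finset.range (m + 2), grunwaldCoeff α k ≤ 0 := by
  have h := alpha_mul_sum_grunwaldCoeff α (m + 1)
  have h3 : 0 ≤ (((m + 1 : ℕ) : ℝ) + 1) * grunwaldCoeff α (m + 2) :=
    mul_nonneg (by positivity) (grunwaldCoeff_nonneg h1 h2 m)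
  by_contra! hc
  have := mul_pos (by linarith : (0 : ℝ) < α) hc
  linarith

theorem sum_weightedCoeff (α : ℝ) (m : ℕ) :
    ∑ k ∈ Finset.range (m + 1), weightedCoeff α k =
      α / 2 * ∑ k ∈ Finset.range (m + 1), grunwaldCoeff α k +
        (2 - α) / 2 * ∑ k ∈ Finset.range m, grunwaldCoeff α k := by
  induction m with
  | zero => simp [weightedCoeff]
  | succ m ih =>
    rw [Finset.sum_range_succ, ih, weightedCoeff_succ, Finset.sum_range_succ _ (m + 1),
      Finset.sum_range_succ _ m]
    ring

theorem sum_weightedCoeff_nonpos (h1 : 1 < α) (h2 : α < 2) (m : ℕ) :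
    ∑ k ∈ Finset.range (m + 3), weightedCoeff α k ≤ 0 := by
  rw [sum_weightedCoeff]
  have := sum_grunwaldCoeff_nonpos h1 h2 m
  have := sum_grunwaldCoeff_nonpos h1 h2 (m + 1)
  nlinarith

/-- Index `3` is the right start: `w_2` involves `g_1 = -α` and is negative for `α` near `1`. It
enters the symmetric part only through `w_0 + w_2`. -/
theorem weightedCoeff_nonneg (h1 : 1 < α) (h2 : α < 2) (k : ℕ) :
    0 ≤ weightedCoeff α (k + 3) := by
  rw [weightedCoeff_succ]
  have := grunwaldCoeff_nonneg h1 h2 k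
  have := grunwaldCoeff_nonneg h1 h2 (k + 1)
  have : 0 ≤ α / 2 * grunwaldCoeff α (k + 2 + 1) := mul_nonneg (by linarith) this
  have : 0 ≤ (2 - α) / 2 * grunwaldCoeff α (k + 2) := mul_nonneg (by linarith) (by assumption)
  linarith

theorem weightedCoeff_succ_le (h1 : 1 < α) (h2 : α < 2) (k : ℕ) :
    weightedCoeff α (k + 4) ≤ weightedCoeff α (k + 3) := by
  rw [weightedCoeff_succ, weightedCoeff_succ]
  have h3 := grunwaldCoeff_succ_le h1 h2 k
  have h4 := grunwaldCoeff_succ_le h1 h2 (k + 1)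
  have := mul_le_mul_of_nonneg_left h3 (by linarith : (0 : ℝ) ≤ (2 - α) / 2)
  have := mul_le_mul_of_nonneg_left h4 (by linarith : (0 : ℝ) ≤ α / 2)
  exact add_le_add (by assumption) (by assumption)

/-- Minus the off-diagonal Toeplitz coefficients of the symmetric part of `L_m^{(α)}`. -/
noncomputable def offDiag (α : ℝ) (l : ℕ) : ℝ :=
  if l = 1 then (weightedCoeff α 0 + weightedCoeff α 2) / 2 else weightedCoeff α (l + 1) / 2

theorem offDiag_one (α : ℝ) : offDiag α 1 = α * (α - 1) * (α + 2) / 8 := by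
  norm_num [offDiag, weightedCoeff, grunwaldCoeff]
  ring

theorem offDiag_add_two (α : ℝ) (l : ℕ) : offDiag α (l + 2) = weightedCoeff α (l + 3) / 2 := by
  simp [offDiag]

theorem offDiag_nonneg (h1 : 1 < α) (h2 : α < 2) (l : ℕ) : 0 ≤ offDiag α (l + 1) := by
  rcases l with _ | l
  · have : 0 ≤ α * (α - 1) * (α + 2) :=
      mul_nonneg (mul_nonneg (by linarith) (by linarith)) (by linarith)
    rw [offDiag_one]; linarith
  · rw [offDiag_add_two]
    linarith [weightedCoeff_nonneg h1 h2 l]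

/-- Only the step from lag `1` to lag `2` is not inherited from the weights. There both sides share
the factor `α (α - 1) / 2`, and a quadratic inequality in `α` remains. -/
theorem offDiag_antitone (h1 : 1 < α) (h2 : α < 2) : Antitone fun l => offDiag α (l + 1) := by
  refine antitone_nat_of_succ_le fun l => ?_
  rcases l with _ | l
  · rw [offDiag_add_two, offDiag_one]
    have : weightedCoeff α 3 = α * (α - 1) / 2 * ((2 - α) * (α + 3) / 6) := by
      norm_num [weightedCoeff, grunwaldCoeff]
      ring
    rw [zero_add, this]
    have h3 : (0 : ℝ) ≤ α * (α - 1) / 2 := by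
      have := mul_nonneg (by linarith : (0 : ℝ) ≤ α) (by linarith : (0 : ℝ) ≤ α - 1)
      linarith
    have := mul_le_mul_of_nonneg_left
      (by nlinarith : (2 - α) * (α + 3) / 6 ≤ (α + 2) / 2) h3
    linarith
  · simp only [offDiag_add_two]
    linarith [weightedCoeff_succ_le h1 h2 l]

/-- For `m ≥ 2` the doubled sum is `w_0 + w_2 + w_3 + ⋯ + w_m`, a nonpositive partial sum of the
weights with `w_1` removed. -/
theorem two_mul_sum_offDiag_le (h1 : 1 < α) (h2 : α < 2) (m : ℕ) :
    2 * ∑ l ∈ Finset.Ico 1 m, offDiag α l ≤ -weightedCoeff α 1 := by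
  rcases m with _ | _ | m
  · norm_num [weightedCoeff, grunwaldCoeff]; nlinarith
  · norm_num [weightedCoeff, grunwaldCoeff]; nlinarith
  · have h : 2 * ∑ l ∈ Finset.Ico 1 (m + 2), offDiag α l =
        ∑ k ∈ Finset.range (m + 3), weightedCoeff α k - weightedCoeff α 1 := by
      induction m with
      | zero => simp [offDiag, Finset.sum_range_succ]; ring
      | succ m ih =>
        rw [Finset.sum_Ico_succ_top (by omega), mul_add, ih, Finset.sum_range_succ _ (m + 3),
          offDiag_add_two]
        ring
    linarith [sum_weightedCoeff_nonpos h1 h2 m]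

end Coefficients

/-! ### Weak diagonal dominance and semidefiniteness. -/

section DiagonalDominance

/-- Each cross term costs at most `|B i j| (x i ^ 2 + x j ^ 2) / 2`. By symmetry of `B` both halves
can be charged to row `i`, where the diagonal entry pays for them. -/
theorem dotProduct_mulVec_nonneg_of_sum_le {ι : Type*} [Fintype ι] [DecidableEq ι]
    {B : Matrix ι ι ℝ} (hB : B.IsSymm) (h : ∀ i, ∑ j ∈ Finset.univ.erase i, |B i j| ≤ B i i)
    (x : ι → ℝ) : 0 ≤ x ⬝ᵥ (B *ᵥ x) := by
  have hx : x ⬝ᵥ (B *ᵥ x) = ∑ i, (B i i * x i ^ 2 +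
      ∑ j ∈ Finset.univ.erase i, B i j * (x i * x j)) := by
    simp only [dotProduct, mulVec, Finset.mul_sum]
    refine Finset.sum_congr rfl fun i _ => ?_
    rw [← Finset.add_sum_erase _ _ (Finset.mem_univ i)]
    congr 1
    · ring
    · exact Finset.sum_congr rfl fun j _ => by ring
  have hterm : ∀ i j, -(|B i j| * x i ^ 2 + |B i j| * x j ^ 2) / 2 ≤ B i j * (x i * x j) := by
    intro i j
    have h1 : |B i j * (x i * x j)| ≤ |B i j| * ((x i ^ 2 + x j ^ 2) / 2) := by
      rw [abs_mul]
      refine mul_le_mul_of_nonneg_left ?_ (abs_nonneg _)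
      rw [abs_le]
      constructor <;> nlinarith [sq_nonneg (x i + x j), sq_nonneg (x i - x j)]
    have := neg_abs_le (B i j * (x i * x j))
    linarith
  have hswap : ∑ i, ∑ j ∈ Finset.univ.erase i, |B i j| * x j ^ 2 =
      ∑ i, ∑ j ∈ Finset.univ.erase i, |B i j| * x i ^ 2 := by
    rw [Finset.sum_comm' (t' := Finset.univ) (s' := fun j => Finset.univ.erase j)
      (by simp [eq_comm])]
    refine Finset.sum_congr rfl fun i _ => Finset.sum_congr rfl fun j _ => ?_
    rw [hB.apply]
  have hlow : ∑ i, (B i i * x i ^ 2 +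
      ∑ j ∈ Finset.univ.erase i, -(|B i j| * x i ^ 2 + |B i j| * x j ^ 2) / 2) ≤
      x ⬝ᵥ (B *ᵥ x) := by
    rw [hx]
    exact Finset.sum_le_sum fun i _ => by
      gcongr with j
      exact hterm i j
  refine le_trans ?_ hlow
  have : ∑ i, (B i i * x i ^ 2 +
      ∑ j ∈ Finset.univ.erase i, -(|B i j| * x i ^ 2 + |B i j| * x j ^ 2) / 2) =
      ∑ i, (B i i - ∑ j ∈ Finset.univ.erase i, |B i j|) * x i ^ 2 := by
    have e : ∀ i, (B i i * x i ^ 2 +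
        ∑ j ∈ Finset.univ.erase i, -(|B i j| * x i ^ 2 + |B i j| * x j ^ 2) / 2) =
        B i i * x i ^ 2 - (∑ j ∈ Finset.univ.erase i, |B i j| * x i ^ 2) / 2 -
          (∑ j ∈ Finset.univ.erase i, |B i j| * x j ^ 2) / 2 := by
      intro i
      rw [Finset.sum_div, Finset.sum_div, sub_sub, ← Finset.sum_add_distrib, sub_eq_add_neg,
        ← Finset.sum_neg_distrib]
      congr 1
      exact Finset.sum_congr rfl fun j _ => by ring
    rw [Finset.sum_congr rfl fun i _ => e i]
    simp only [Finset.sum_sub_distrib, ← Finset.sum_div, hswap, sub_mul, Finset.sum_mul]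
    ring
  rw [this]
  exact Finset.sum_nonneg fun i _ => mul_nonneg (sub_nonneg.2 (h i)) (sq_nonneg _)

end DiagonalDominance

/-! ### Comparison of the symmetric Toeplitz part with its tau approximation. -/

section Tau

theorem sum_comp_le_sum {s : ℕ → ℝ} {J K : Finset ℕ} {f : ℕ → ℕ} (hs : ∀ l ∈ K, 0 ≤ s l)
    (hf : Set.InjOn f J) (hJ : ∀ j ∈ J, f j ∈ K) : ∑ j ∈ J, s (f j) ≤ ∑ l ∈ K, s l := by
  rw [← Finset.sum_image (f := s) hf]
  exact Finset.sum_le_sum_of_subset_of_nonneg (Finset.image_subset_iff.2 hJ)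
    fun l hl _ => hs l hl

/-- The modulus of the entries of the Hankel correction. -/
noncomputable def hankelEntry (s : ℕ → ℝ) (m i j : ℕ) : ℝ :=
  if i + j + 2 < m then s (i + j + 2) else if 2 * m - (i + j) < m then s (2 * m - (i + j)) else 0

/-- The lags left of the diagonal fill `[1, i]` and the upper Hankel corner uses indices beyond `i`.
The lags to the right fill `[1, m - i)` and the lower corner uses indices from `m - i` on. Each pair
fits into one copy of `[1, m)`. -/
theorem sum_toeplitz_add_hankel_le {s : ℕ → ℝ} (hs : ∀ l, 0 ≤ s (l + 1)) {m i : ℕ} (hi : i < m) :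
    ∑ j ∈ (Finset.range m).erase i, s (max i j - min i j) +
      ∑ j ∈ Finset.range m, hankelEntry s m i j ≤ 2 * ∑ l ∈ Finset.Ico 1 m, s l := by
  have hs' : ∀ l, l ≠ 0 → 0 ≤ s l := fun l hl => by
    obtain ⟨k, rfl⟩ := Nat.exists_eq_succ_of_ne_zero hl
    exact hs k
  have e1 : (Finset.range m).erase i = Finset.range i ∪ Finset.Ioo i m := by
    ext j; simp; omega
  have e2 : ∑ j ∈ (Finset.range m).erase i, s (max i j - min i j) =
      ∑ j ∈ Finset.range i, s (i - j) + ∑ j ∈ Finset.Ioo i m, s (j - i) := by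
    rw [e1, Finset.sum_union]
    · congr 1
      · refine Finset.sum_congr rfl fun j hj => ?_
        rw [Finset.mem_range] at hj
        congr 1; omega
      · refine Finset.sum_congr rfl fun j hj => ?_
        rw [Finset.mem_Ioo] at hj
        congr 1; omega
    · rw [Finset.disjoint_left]; intro j; simp; omega
  have e3 : ∑ j ∈ Finset.range m, hankelEntry s m i j =
      ∑ j ∈ (Finset.range m).filter (fun j => i + j + 2 < m), s (i + j + 2) +
      ∑ j ∈ (Finset.range m).filter (fun j => 2 * m - (i + j) < m), s (2 * m - (i + j)) := by
    rw [Finset.sum_filter, Finset.sum_filter, ← Finset.sum_add_distrib]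
    refine Finset.sum_congr rfl fun j hj => ?_
    rw [Finset.mem_range] at hj
    unfold hankelEntry
    split_ifs <;> first | omega | simp
  have b1 : ∑ j ∈ Finset.range i, s (i - j) ≤ ∑ l ∈ Finset.Ico 1 (i + 1), s l := by
    refine sum_comp_le_sum (f := fun j => i - j) (fun l hl => hs' l ?_) ?_ ?_
    · rw [Finset.mem_Ico] at hl; omega
    · intro a ha b hb; simp at ha hb ⊢; omega
    · intro a; simp; omega
  have b2 : ∑ j ∈ (Finset.range m).filter (fun j => i + j + 2 < m), s (i + j + 2) ≤
      ∑ l ∈ Finset.Ico (i + 1) m, s l := by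
    refine sum_comp_le_sum (f := fun j => i + j + 2) (fun l hl => hs' l ?_) ?_ ?_
    · rw [Finset.mem_Ico] at hl; omega
    · intro a ha b hb; simp
    · intro a; simp; omega
  have b3 : ∑ j ∈ Finset.Ioo i m, s (j - i) ≤ ∑ l ∈ Finset.Ico 1 (m - i), s l := by
    refine sum_comp_le_sum (f := fun j => j - i) (fun l hl => hs' l ?_) ?_ ?_
    · rw [Finset.mem_Ico] at hl; omega
    · intro a ha b hb; simp at ha hb ⊢; omega
    · intro a; simp; omega
  have b4 : ∑ j ∈ (Finset.range m).filter (fun j => 2 * m - (i + j) < m), s (2 * m - (i + j)) ≤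
      ∑ l ∈ Finset.Ico (m - i) m, s l := by
    refine sum_comp_le_sum (f := fun j => 2 * m - (i + j)) (fun l hl => hs' l ?_) ?_ ?_
    · rw [Finset.mem_Ico] at hl; omega
    · intro a ha b hb; simp at ha hb ⊢; omega
    · intro a; simp; omega
  have c1 := Finset.sum_Ico_consecutive s (show 1 ≤ i + 1 by omega) (show i + 1 ≤ m by omega)
  have c2 := Finset.sum_Ico_consecutive s (show 1 ≤ m - i by omega) (show m - i ≤ m by omega)
  rw [e2, e3]
  linarith

variable {α : ℝ} {m : ℕ}

theorem symPart_isSymm (Z : Matrix (Fin m) (Fin m) ℝ) : (symPart Z).IsSymm := by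
  simp [Matrix.IsSymm, symPart, add_comm]

theorem symPart_grunwaldMatrix_apply (α : ℝ) (i j : Fin m) :
    symPart (grunwaldMatrix α m) i j = if i = j then -weightedCoeff α 1
      else -offDiag α (max (i : ℕ) j - min (i : ℕ) j) := by
  simp only [symPart, grunwaldMatrix, Matrix.smul_apply, Matrix.add_apply, Matrix.of_apply,
    Matrix.transpose_apply, smul_eq_mul]
  by_cases hij : i = j
  · subst hij
    simp
    ring
  · rw [if_neg hij]
    have hne : (i : ℕ) ≠ j := fun h => hij (Fin.ext h)
    rcases lt_or_gt_of_ne hne with h | h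
    · obtain ⟨c, hc⟩ : ∃ c, (j : ℕ) = i + 1 + c := ⟨j - i - 1, by omega⟩
      rw [hc, max_eq_right (by omega), min_eq_left (by omega), if_pos (by omega : (i : ℕ) ≤ _)]
      have e : (i : ℕ) + 1 + c - i = c + 1 := by omega
      have e' : (i : ℕ) + 1 + c + 1 - i = c + 2 := by omega
      rw [e, e']
      rcases c with _ | c
      · simp [offDiag]; ring
      · rw [if_neg (by omega), offDiag_add_two]; ring
    · obtain ⟨c, hc⟩ : ∃ c, (i : ℕ) = j + 1 + c := ⟨i - j - 1, by omega⟩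
      rw [hc, max_eq_left (by omega), min_eq_right (by omega), if_pos (by omega : (j : ℕ) ≤ _)]
      have e : (j : ℕ) + 1 + c - j = c + 1 := by omega
      have e' : (j : ℕ) + 1 + c + 1 - j = c + 2 := by omega
      rw [e, e']
      rcases c with _ | c
      · simp [offDiag]; ring
      · rw [if_neg (by omega), offDiag_add_two]; ring

theorem hankelCorrection_symPart_apply (α : ℝ) (i j : Fin m) :
    hankelCorrection (symPart (grunwaldMatrix α m)) i j = -hankelEntry (offDiag α) m i j := by
  have hi := i.2
  have hj := j.2
  simp only [hankelCorrection, hankelEntry, Matrix.of_apply, symPart_grunwaldMatrix_apply,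
    Fin.mk.injEq]
  split_ifs <;> first | omega | (exfalso; omega) | simp_all

theorem hankelCorrection_isSymm (T : Matrix (Fin m) (Fin m) ℝ) : (hankelCorrection T).IsSymm := by
  ext i j
  simp only [Matrix.transpose_apply, hankelCorrection, Matrix.of_apply, add_comm (j : ℕ)]

theorem tauMatrix_symPart_isSymm (Z : Matrix (Fin m) (Fin m) ℝ) :
    (tauMatrix (symPart Z)).IsSymm :=
  (symPart_isSymm Z).sub (hankelCorrection_isSymm _)

theorem hankelEntry_nonneg (h1 : 1 < α) (h2 : α < 2) {i j : ℕ} (hi : i < m) (hj : j < m) :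
    0 ≤ hankelEntry (offDiag α) m i j := by
  unfold hankelEntry
  split_ifs with h h'
  · exact offDiag_nonneg h1 h2 _
  · obtain ⟨c, hc⟩ : ∃ c, 2 * m - (i + j) = c + 1 := ⟨2 * m - (i + j) - 1, by omega⟩
    rw [hc]; exact offDiag_nonneg h1 h2 _
  · exact le_rfl

/-- Both Hankel indices `i + j + 2` and `2 m - (i + j)` exceed the lag `|i - j|`, and the
coefficients decrease. -/
theorem hankelEntry_le_offDiag (h1 : 1 < α) (h2 : α < 2) {i j : ℕ} (hi : i < m) (hj : j < m)
    (hij : i ≠ j) : hankelEntry (offDiag α) m i j ≤ offDiag α (max i j - min i j) := by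
  obtain ⟨c, hc⟩ : ∃ c, max i j - min i j = c + 1 := ⟨max i j - min i j - 1, by omega⟩
  unfold hankelEntry
  rw [hc]
  split_ifs with h h'
  · exact offDiag_antitone h1 h2 (show c ≤ i + j + 1 by omega)
  · obtain ⟨e, he⟩ : ∃ e, 2 * m - (i + j) = e + 1 := ⟨2 * m - (i + j) - 1, by omega⟩
    rw [he]
    exact offDiag_antitone h1 h2 (show c ≤ e by omega)
  · exact offDiag_nonneg h1 h2 c

theorem sum_offDiag_add_hankelEntry_le (h1 : 1 < α) (h2 : α < 2) (i : Fin m) :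
    ∑ j ∈ Finset.univ.erase i, (offDiag α (max (i : ℕ) j - min (i : ℕ) j) +
      hankelEntry (offDiag α) m i j) + hankelEntry (offDiag α) m i i ≤ -weightedCoeff α 1 := by
  have h := (sum_toeplitz_add_hankel_le (offDiag_nonneg h1 h2) i.2).trans
    (two_mul_sum_offDiag_le h1 h2 m)
  refine le_trans (le_of_eq ?_) h
  have e : (Finset.range m).erase (i : ℕ) = (Finset.univ.erase i).map Fin.valEmbedding := by
    ext j
    simp only [Finset.mem_erase, Finset.mem_range, Finset.mem_map, Finset.mem_univ, and_true,
      Fin.valEmbedding_apply]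
    constructor
    · rintro ⟨h3, h4⟩
      exact ⟨⟨j, h4⟩, fun h5 => h3 (by rw [← h5]), rfl⟩
    · rintro ⟨k, h3, rfl⟩
      exact ⟨fun h4 => h3 (Fin.ext h4), k.2⟩
  rw [← Finset.add_sum_erase (Finset.range m) (fun j => hankelEntry _ m i j)
    (Finset.mem_range.2 i.2), e, Finset.sum_map, Finset.sum_map, Finset.sum_add_distrib]
  simp only [Fin.valEmbedding_apply]
  ring

theorem symPart_add_hankel_form_nonneg (h1 : 1 < α) (h2 : α < 2) (x : Fin m → ℝ) :
    0 ≤ x ⬝ᵥ ((symPart (grunwaldMatrix α m) +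
      hankelCorrection (symPart (grunwaldMatrix α m))) *ᵥ x) := by
  refine dotProduct_mulVec_nonneg_of_sum_le
    ((symPart_isSymm _).add (hankelCorrection_isSymm _)) (fun i => ?_) x
  simp only [Matrix.add_apply, hankelCorrection_symPart_apply, symPart_grunwaldMatrix_apply,
    if_true]
  refine le_trans (Finset.sum_le_sum fun j hj => ?_)
    (by linarith [sum_offDiag_add_hankelEntry_le h1 h2 i])
  have hne : i ≠ j := (Finset.ne_of_mem_erase hj).symm
  have hv : (i : ℕ) ≠ j := fun h => hne (Fin.ext h)
  have := hankelEntry_nonneg h1 h2 i.2 j.2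
  have := hankelEntry_le_offDiag h1 h2 i.2 j.2 hv
  rw [if_neg hne, abs_le]
  constructor <;> linarith

/-- With off-diagonal moduli `s` and `h` of the Toeplitz and Hankel parts, `0 ≤ h ≤ s` gives `|3 h -
s| ≤ s + h`. The row sum bound that handles `T + K` therefore also handles `T - 3 K`. -/
theorem symPart_sub_hankel_form_nonneg (h1 : 1 < α) (h2 : α < 2) (x : Fin m → ℝ) :
    0 ≤ x ⬝ᵥ ((symPart (grunwaldMatrix α m) -
      (3 : ℝ) • hankelCorrection (symPart (grunwaldMatrix α m))) *ᵥ x) := by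
  refine dotProduct_mulVec_nonneg_of_sum_le
    ((symPart_isSymm _).sub ((hankelCorrection_isSymm _).smul _)) (fun i => ?_) x
  simp only [Matrix.sub_apply, Matrix.smul_apply, smul_eq_mul, hankelCorrection_symPart_apply,
    symPart_grunwaldMatrix_apply, if_true]
  have h0 := hankelEntry_nonneg h1 h2 i.2 i.2
  refine le_trans (Finset.sum_le_sum fun j hj => ?_)
    (by linarith [sum_offDiag_add_hankelEntry_le h1 h2 i])
  have hne : i ≠ j := (Finset.ne_of_mem_erase hj).symm
  have hv : (i : ℕ) ≠ j := fun h => hne (Fin.ext h)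
  have := hankelEntry_nonneg h1 h2 i.2 j.2
  have := hankelEntry_le_offDiag h1 h2 i.2 j.2 hv
  rw [if_neg hne, abs_le]
  constructor <;> linarith

/-- `τ(H(L)) ≥ 0` and `τ(H(L)) / 2 ≤ H(L) ≤ 3 τ(H(L)) / 2` as quadratic forms. -/
theorem tauMatrix_form_bounds (h1 : 1 < α) (h2 : α < 2) (x : Fin m → ℝ) :
    0 ≤ x ⬝ᵥ (tauMatrix (symPart (grunwaldMatrix α m)) *ᵥ x) ∧
    1 / 2 * (x ⬝ᵥ (tauMatrix (symPart (grunwaldMatrix α m)) *ᵥ x)) ≤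
      x ⬝ᵥ (symPart (grunwaldMatrix α m) *ᵥ x) ∧
    x ⬝ᵥ (symPart (grunwaldMatrix α m) *ᵥ x) ≤
      3 / 2 * (x ⬝ᵥ (tauMatrix (symPart (grunwaldMatrix α m)) *ᵥ x)) := by
  have ha := symPart_add_hankel_form_nonneg h1 h2 x
  have hb := symPart_sub_hankel_form_nonneg h1 h2 x
  simp only [tauMatrix, Matrix.sub_mulVec, Matrix.add_mulVec, dotProduct_add, dotProduct_sub,
    Matrix.smul_mulVec, dotProduct_smul, smul_eq_mul] at ha hb ⊢
  refine ⟨?_, ?_, ?_⟩ <;> linarith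

/-- `τ(H(L))` is centrosymmetric. -/
theorem tauMatrix_rev (α : ℝ) (i j : Fin m) :
    tauMatrix (symPart (grunwaldMatrix α m)) i.rev j.rev =
      tauMatrix (symPart (grunwaldMatrix α m)) i j := by
  have hi := i.2
  have hj := j.2
  simp only [tauMatrix, Matrix.sub_apply, hankelCorrection_symPart_apply,
    symPart_grunwaldMatrix_apply, Fin.rev_inj, Fin.val_rev]
  congr 1
  · congr 3
    omega
  · congr 1
    unfold hankelEntry
    split_ifs <;> first | omega | rfl | (congr 1; omega)

/-- `L` is persymmetric. -/
theorem grunwaldMatrix_rev (α : ℝ) (i j : Fin m) :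
    grunwaldMatrix α m i.rev j.rev = grunwaldMatrix α m j i := by
  have hi := i.2
  have hj := j.2
  simp only [grunwaldMatrix, Matrix.of_apply, Fin.val_rev]
  split_ifs <;> first | omega | rfl | (congr 2; omega)

end Tau

/-! ### The generating function of the weights on the unit circle. -/

section Symbol

variable {α : ℝ}

theorem summable_grunwaldCoeff (h1 : 1 < α) (h2 : α < 2) : Summable (grunwaldCoeff α) := by
  rw [← summable_nat_add_iff 2]
  -- As `g_0 + g_1 = 1 - α` and partial sums are nonpositive, the nonnegative tail sums to at most
  -- `α - 1`.
  refine summable_of_sum_range_le (c := α - 1) (grunwaldCoeff_nonneg h1 h2) fun n => ?_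
  have h := sum_grunwaldCoeff_nonpos h1 h2 n
  rw [Finset.sum_range_succ', Finset.sum_range_succ'] at h
  simp only [add_assoc, Nat.reduceAdd] at h
  have e : grunwaldCoeff α 0 = 1 := rfl
  have e' : grunwaldCoeff α 1 = -α := by norm_num [grunwaldCoeff]
  rw [e, e'] at h
  linarith

theorem grunwaldCoeff_eq_choose (α : ℝ) (k : ℕ) :
    (grunwaldCoeff α k : ℂ) = (-1) ^ k * Ring.choose (α : ℂ) k := by
  induction k with
  | zero => simp [grunwaldCoeff]
  | succ k ih =>
    have h := succ_mul_grunwaldCoeff_succ α k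
    have hC : ((k : ℂ) + 1) * grunwaldCoeff α (k + 1) = (k - α) * grunwaldCoeff α k := by
      exact_mod_cast h
    have hk : (k : ℂ) + 1 ≠ 0 := by exact_mod_cast Nat.succ_ne_zero k
    have hc := Ring.choose_smul_choose (α : ℂ) (Nat.le_succ k)
    simp only [Nat.succ_eq_add_one, Nat.choose_succ_self_right, Nat.add_sub_cancel_left,
      Ring.choose_one_right, nsmul_eq_mul] at hc
    push_cast at hc
    apply mul_left_cancel₀ hk
    rw [hC, ih, pow_succ]
    linear_combination (-1 : ℂ) ^ k * hc

theorem hasSum_grunwaldCoeff_of_norm_lt_one (α : ℝ) {z : ℂ} (hz : ‖z‖ < 1) :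
    HasSum (fun k => (grunwaldCoeff α k : ℂ) * z ^ k) ((1 - z) ^ (α : ℂ)) := by
  have h := (Complex.one_add_cpow_hasFPowerSeriesOnBall_zero (a := (α : ℂ))).hasSum
    (y := -z) (by
      rw [← ENNReal.ofReal_one, Metric.eball_ofReal]
      simpa using hz)
  rw [zero_add, ← sub_eq_add_neg] at h
  have e : ∀ k, (binomialSeries ℂ (α : ℂ) k fun _ => -z) = (grunwaldCoeff α k : ℂ) * z ^ k := by
    intro k
    rw [binomialSeries_apply, List.ofFn_const, List.prod_replicate, grunwaldCoeff_eq_choose,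
      neg_pow, smul_eq_mul]
    ring
  simpa only [e] using h

theorem summable_norm_grunwaldCoeff (h1 : 1 < α) (h2 : α < 2) :
    Summable fun k => ‖(grunwaldCoeff α k : ℂ)‖ := by
  simpa using (summable_grunwaldCoeff h1 h2).abs

/-- The boundary circle is reached by continuity: the series converges uniformly on the closed disc,
`(1 - z)^α` is continuous there because `Re (1 - z) ≥ 0` and `α > 0`, and the two agree inside. -/
theorem hasSum_grunwaldCoeff (h1 : 1 < α) (h2 : α < 2) {z : ℂ} (hz : ‖z‖ ≤ 1) :
    HasSum (fun k => (grunwaldCoeff α k : ℂ) * z ^ k) ((1 - z) ^ (α : ℂ)) := by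
  have hbd : ∀ k, ∀ y ∈ Metric.closedBall (0 : ℂ) 1,
      ‖(grunwaldCoeff α k : ℂ) * y ^ k‖ ≤ ‖(grunwaldCoeff α k : ℂ)‖ := by
    intro k y hy
    rw [norm_mul, norm_pow]
    exact mul_le_of_le_one_right (norm_nonneg _)
      (pow_le_one₀ (norm_nonneg _) (by simpa using hy))
  have hmem : z ∈ Metric.closedBall (0 : ℂ) 1 := by simpa using hz
  have hsum : Summable fun k => (grunwaldCoeff α k : ℂ) * z ^ k :=
    Summable.of_norm_bounded (summable_norm_grunwaldCoeff h1 h2) fun k => hbd k z hmem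
  have hcont : ContinuousOn (fun y : ℂ => ∑' k, (grunwaldCoeff α k : ℂ) * y ^ k)
      (Metric.closedBall 0 1) :=
    continuousOn_tsum (fun k => by fun_prop) (summable_norm_grunwaldCoeff h1 h2) hbd
  have hcont' : ContinuousOn (fun y : ℂ => (1 - y) ^ (α : ℂ)) (Metric.closedBall 0 1) := by
    intro y hy
    have hre : 0 ≤ (1 - y).re := by
      have := (Complex.abs_re_le_norm y).trans (by simpa using hy : ‖y‖ ≤ 1)
      simp only [Complex.sub_re, Complex.one_re]
      linarith [le_abs_self y.re]
    have := Complex.continuousAt_cpow_const_of_re_pos (Or.inl hre)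
      (by simp; linarith : 0 < (α : ℂ).re)
    exact (ContinuousAt.comp (f := fun y : ℂ => 1 - y) this (by fun_prop)).continuousWithinAt
  have heq : Set.EqOn (fun y : ℂ => ∑' k, (grunwaldCoeff α k : ℂ) * y ^ k)
      (fun y : ℂ => (1 - y) ^ (α : ℂ)) (Metric.ball 0 1) := fun y hy =>
    (hasSum_grunwaldCoeff_of_norm_lt_one α (by simpa using hy)).tsum_eq
  have heq' := heq.of_subset_closure hcont hcont' Metric.ball_subset_closedBall
    (by rw [closure_ball _ one_ne_zero])
  exact (show _ = (1 - z) ^ (α : ℂ) from heq' hmem) ▸ hsum.hasSum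

theorem hasSum_weightedCoeff (h1 : 1 < α) (h2 : α < 2) {z : ℂ} (hz : ‖z‖ ≤ 1) :
    HasSum (fun k => (weightedCoeff α k : ℂ) * z ^ k)
      ((α / 2 + (2 - α) / 2 * z) * (1 - z) ^ (α : ℂ)) := by
  have h := hasSum_grunwaldCoeff h1 h2 hz
  have ha := (hasSum_nat_add_iff' 1).2 (h.mul_left ((α : ℂ) / 2))
  have hb := h.mul_left ((2 - (α : ℂ)) / 2 * z)
  rw [← hasSum_nat_add_iff' 1]
  convert ha.add hb using 1
  · ext k
    rw [weightedCoeff_succ]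
    push_cast
    ring
  · simp [weightedCoeff]
    ring

theorem summable_norm_weightedCoeff (h1 : 1 < α) (h2 : α < 2) :
    Summable fun k => ‖(weightedCoeff α k : ℂ)‖ := by
  rw [← summable_nat_add_iff 1]
  have h := summable_norm_grunwaldCoeff h1 h2
  refine Summable.of_nonneg_of_le (fun _ => norm_nonneg _) (fun k => ?_)
    ((((summable_nat_add_iff 1).2 h).mul_left ‖(α / 2 : ℂ)‖).add
      (h.mul_left ‖((2 - α) / 2 : ℂ)‖))
  rw [weightedCoeff_succ]
  push_cast
  refine (norm_add_le _ _).trans (by rw [norm_mul, norm_mul])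

theorem integral_exp_int_mul (n : ℤ) :
    ∫ θ in (0 : ℝ)..(2 * Real.pi), Complex.exp (n * (θ * Complex.I)) =
      if n = 0 then (2 * Real.pi : ℂ) else 0 := by
  split_ifs with hn
  · simp [hn]
  · have hc : (n : ℂ) * Complex.I ≠ 0 := mul_ne_zero (by exact_mod_cast hn) Complex.I_ne_zero
    have h := integral_exp_mul_complex (a := 0) (b := 2 * Real.pi) hc
    have e : ∀ θ : ℝ, Complex.exp (n * (θ * Complex.I)) = Complex.exp (n * Complex.I * θ) :=
      fun θ => by ring_nf
    simp only [e]
    rw [h]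
    have : (n : ℂ) * Complex.I * ((2 * Real.pi : ℝ) : ℂ) = n * (2 * Real.pi * Complex.I) := by
      push_cast; ring
    rw [this, Complex.exp_int_mul_two_pi_mul_I]
    simp

/-- The generating function of the weights on the unit circle. -/
noncomputable def weightSymbol (α θ : ℝ) : ℂ :=
  ∑' k, (weightedCoeff α k : ℂ) * Complex.exp (θ * Complex.I) ^ k

theorem weightSymbol_eq (h1 : 1 < α) (h2 : α < 2) (θ : ℝ) :
    weightSymbol α θ = (α / 2 + (2 - α) / 2 * Complex.exp (θ * Complex.I)) *
      (1 - Complex.exp (θ * Complex.I)) ^ (α : ℂ) :=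
  (hasSum_weightedCoeff h1 h2 (Complex.norm_exp_ofReal_mul_I θ).le).tsum_eq

theorem continuous_weightSymbol (h1 : 1 < α) (h2 : α < 2) : Continuous (weightSymbol α) := by
  refine continuous_tsum (fun k => by fun_prop) (summable_norm_weightedCoeff h1 h2) fun k θ => ?_
  simp [Complex.norm_exp_ofReal_mul_I]

/-- Absolute summability of the weights permits termwise integration, and orthogonality of the
exponentials leaves one term. -/
theorem integral_weightSymbol_mul_exp (h1 : 1 < α) (h2 : α < 2) (n : ℤ) :
    ∫ θ in (0 : ℝ)..(2 * Real.pi), weightSymbol α θ * Complex.exp ((-n : ℤ) * (θ * Complex.I)) =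
      if 0 ≤ n then 2 * Real.pi * (weightedCoeff α n.toNat : ℂ) else 0 := by
  have h := intervalIntegral.hasSum_integral_of_dominated_convergence
    (a := 0) (b := 2 * Real.pi) (μ := MeasureTheory.volume)
    (F := fun (k : ℕ) (θ : ℝ) => (weightedCoeff α k : ℂ) * Complex.exp (θ * Complex.I) ^ k *
      Complex.exp ((-n : ℤ) * (θ * Complex.I)))
    (f := fun θ => weightSymbol α θ * Complex.exp ((-n : ℤ) * (θ * Complex.I)))
    (fun k _ => ‖(weightedCoeff α k : ℂ)‖)
    (fun k => (Continuous.aestronglyMeasurable (by fun_prop)))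
    (fun k => Filter.Eventually.of_forall fun θ _ => by
      have : ‖Complex.exp ((-n : ℤ) * (θ * Complex.I))‖ = 1 := by
        have := Complex.norm_exp_ofReal_mul_I (((-n : ℤ) : ℝ) * θ)
        rw [← this]; push_cast; ring_nf
      simp [Complex.norm_exp_ofReal_mul_I, -Int.cast_neg, this])
    (Filter.Eventually.of_forall fun θ _ => summable_norm_weightedCoeff h1 h2)
    intervalIntegrable_const
    (Filter.Eventually.of_forall fun θ _ => (by
      refine HasSum.mul_right _ ?_
      rw [weightSymbol_eq h1 h2]
      exact hasSum_weightedCoeff h1 h2 (Complex.norm_exp_ofReal_mul_I θ).le))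
  have e : ∀ k : ℕ, ∫ θ in (0 : ℝ)..(2 * Real.pi), (weightedCoeff α k : ℂ) *
      Complex.exp (θ * Complex.I) ^ k * Complex.exp ((-n : ℤ) * (θ * Complex.I)) =
      if (k : ℤ) = n then 2 * Real.pi * (weightedCoeff α k : ℂ) else 0 := by
    intro k
    have : ∀ θ : ℝ, (weightedCoeff α k : ℂ) *
      Complex.exp (θ * Complex.I) ^ k * Complex.exp ((-n : ℤ) * (θ * Complex.I)) =
      (weightedCoeff α k : ℂ) * Complex.exp ((k - n : ℤ) * (θ * Complex.I)) := by
      intro θ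
      rw [mul_assoc, ← Complex.exp_nat_mul, ← Complex.exp_add]
      congr 2
      push_cast; ring
    simp only [this]
    rw [intervalIntegral.integral_const_mul, integral_exp_int_mul]
    simp only [sub_eq_zero]
    split_ifs <;> ring
  simp only [e] at h
  rw [← h.tsum_eq]
  split_ifs with hn
  · rw [tsum_eq_single n.toNat]
    · rw [if_pos (by omega)]
    · intro k hk; rw [if_neg (by omega)]
  · convert tsum_zero with k
    rw [if_neg (by omega)]

/-- If `β φ ≥ π`, the left side is nonpositive and the right side nonnegative. Otherwise concavity
of the sine on `[0, π]` gives `sin (t x) ≥ t sin x` with `x = β φ` and `t = (1 - β) / β ≤ 1`. -/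
theorem one_sub_mul_sin_le {β φ : ℝ} (h1 : 1 / 2 ≤ β) (h2 : β ≤ 1) (h3 : 0 ≤ φ)
    (h4 : φ ≤ 2 * Real.pi) :
    (1 - β) * Real.sin (β * φ) ≤ β * Real.sin ((1 - β) * φ) := by
  have ha : 0 ≤ (1 - β) * φ := mul_nonneg (by linarith) h3
  have ha' : (1 - β) * φ ≤ Real.pi := by nlinarith [Real.pi_pos]
  have hsa := Real.sin_nonneg_of_nonneg_of_le_pi ha ha'
  by_cases hb : Real.pi ≤ β * φ
  · have : 0 ≤ -Real.sin (β * φ) := by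
      rw [← Real.sin_sub_pi]
      refine Real.sin_nonneg_of_nonneg_of_le_pi (by linarith) ?_
      nlinarith [Real.pi_pos]
    have := mul_nonneg (by linarith : 0 ≤ 1 - β) this
    have := mul_nonneg (by linarith : 0 ≤ β) hsa
    linarith
  · have hβ : 0 < β := by linarith
    have hc := strictConcaveOn_sin_Icc.concaveOn.2
      (show β * φ ∈ Set.Icc 0 Real.pi from ⟨by positivity, (not_le.1 hb).le⟩)
      (show (0 : ℝ) ∈ Set.Icc 0 Real.pi from ⟨le_rfl, Real.pi_pos.le⟩)
      (show 0 ≤ (1 - β) / β from div_nonneg (by linarith) hβ.le)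
      (show 0 ≤ 1 - (1 - β) / β by rw [sub_nonneg, div_le_one hβ]; linarith) (by ring)
    simp only [smul_eq_mul, Real.sin_zero, mul_zero, add_zero] at hc
    have e : (1 - β) / β * (β * φ) = (1 - β) * φ := by field_simp
    rw [e, div_mul_eq_mul_div, div_le_iff₀ hβ] at hc
    linarith

/-- Polar form: `1 - e^{iθ} = 2 sin (θ/2) e^{i(θ-π)/2}`, with angle inside the principal branch. -/
theorem one_sub_exp_cpow (α : ℝ) {θ : ℝ} (h1 : 0 < θ) (h2 : θ < 2 * Real.pi) :
    (1 - Complex.exp (θ * Complex.I)) ^ (α : ℂ) =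
      ((2 * Real.sin (θ / 2)) ^ α : ℝ) *
        Complex.exp (((α / 2 * (θ - Real.pi) : ℝ) : ℂ) * Complex.I) := by
  have hs : 0 < Real.sin (θ / 2) := Real.sin_pos_of_pos_of_lt_pi (by linarith) (by linarith)
  have e : 1 - Complex.exp (θ * Complex.I) = ((2 * Real.sin (θ / 2) : ℝ) : ℂ) *
      Complex.exp ((((θ - Real.pi) / 2 : ℝ) : ℂ) * Complex.I) := by
    have e1 : Complex.exp (θ * Complex.I) =
        Complex.exp (((θ / 2 : ℝ) : ℂ) * Complex.I) *
          Complex.exp (((θ / 2 : ℝ) : ℂ) * Complex.I) := by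
      rw [← Complex.exp_add]; push_cast; ring_nf
    have e2 : Complex.exp ((((θ - Real.pi) / 2 : ℝ) : ℂ) * Complex.I) =
        Complex.exp (((θ / 2 : ℝ) : ℂ) * Complex.I) * (-Complex.I) := by
      have : -Complex.I = Complex.exp (((-(Real.pi / 2) : ℝ) : ℂ) * Complex.I) := by
        rw [Complex.exp_mul_I, ← Complex.ofReal_cos, ← Complex.ofReal_sin]; simp
      rw [this, ← Complex.exp_add]; push_cast; ring_nf
    rw [e1, e2, Complex.exp_mul_I, ← Complex.ofReal_cos, ← Complex.ofReal_sin]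
    have hcs := Real.sin_sq_add_cos_sq (θ / 2)
    generalize Real.sin (θ / 2) = s at *
    generalize Real.cos (θ / 2) = c at *
    apply Complex.ext
    · simp; nlinarith
    · simp; ring
  have hr : 0 < 2 * Real.sin (θ / 2) := by positivity
  rw [e, Complex.cpow_def_of_ne_zero
      (mul_ne_zero (by exact_mod_cast hr.ne') (Complex.exp_ne_zero _)),
    Complex.log_ofReal_mul hr (Complex.exp_ne_zero _), Complex.log_exp
      (by rw [Complex.im_ofReal_mul, Complex.I_im]; linarith)
      (by rw [Complex.im_ofReal_mul, Complex.I_im]; linarith [Real.pi_pos]),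
    Real.rpow_def_of_pos hr, add_mul, Complex.exp_add]
  push_cast
  congr 2
  ring

/-- The rotated symbol lies in the right half plane. -/
theorem rotated_symbol_re_nonneg (h1 : 1 < α) (h2 : α < 2) {θ : ℝ} (h3 : 0 ≤ θ)
    (h4 : θ ≤ 2 * Real.pi) :
    0 ≤ (Complex.I * Complex.exp (((α / 2 * Real.pi : ℝ) : ℂ) * Complex.I) *
      (weightSymbol α θ * Complex.exp (-(θ * Complex.I)))).re := by
  have hα : (α : ℂ) ≠ 0 := by exact_mod_cast (by linarith : α ≠ 0)
  rw [weightSymbol_eq h1 h2]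
  -- At both endpoints `1 - e^{iθ}` vanishes, where the polar form is unavailable.
  rcases h3.eq_or_lt with rfl | h3
  · simp [hα]
  rcases h4.eq_or_lt with rfl | h4
  · push_cast; rw [Complex.exp_two_pi_mul_I]; simp [hα]
  have hs : 0 < Real.sin (θ / 2) := Real.sin_pos_of_pos_of_lt_pi (by linarith) (by linarith)
  have hR : 0 ≤ (2 * Real.sin (θ / 2)) ^ α := by positivity
  rw [one_sub_exp_cpow α h3 h4]
  generalize (2 * Real.sin (θ / 2)) ^ α = R at *
  -- The rotation cancels the constant phase `-απ/2`. With `β = α/2` the factor `β e^{-i(1-β)θ} +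
  -- (1-β) e^{iβθ}` remains, and the extra `I` makes the real part minus its imaginary part.
  have e : Complex.I * Complex.exp (((α / 2 * Real.pi : ℝ) : ℂ) * Complex.I) *
      ((α / 2 + (2 - α) / 2 * Complex.exp (θ * Complex.I)) *
      (R * Complex.exp (((α / 2 * (θ - Real.pi) : ℝ) : ℂ) * Complex.I)) *
        Complex.exp (-(θ * Complex.I))) =
      R * (Complex.I * (((α / 2 : ℝ) : ℂ) *
        Complex.exp (((-((1 - α / 2) * θ) : ℝ) : ℂ) * Complex.I) +
        ((1 - α / 2 : ℝ) : ℂ) * Complex.exp (((α / 2 * θ : ℝ) : ℂ) * Complex.I))) := by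
    have e1 : Complex.exp (((-((1 - α / 2) * θ) : ℝ) : ℂ) * Complex.I) =
        Complex.exp (((α / 2 * Real.pi : ℝ) : ℂ) * Complex.I) *
        Complex.exp (((α / 2 * (θ - Real.pi) : ℝ) : ℂ) * Complex.I) *
        Complex.exp (-(θ * Complex.I)) := by
      rw [← Complex.exp_add, ← Complex.exp_add]; push_cast; ring_nf
    have e2 : Complex.exp (((α / 2 * θ : ℝ) : ℂ) * Complex.I) =
        Complex.exp (((α / 2 * Real.pi : ℝ) : ℂ) * Complex.I) *
        Complex.exp (((α / 2 * (θ - Real.pi) : ℝ) : ℂ) * Complex.I) *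
        Complex.exp (-(θ * Complex.I)) * Complex.exp (θ * Complex.I) := by
      rw [← Complex.exp_add, ← Complex.exp_add, ← Complex.exp_add]; push_cast; ring_nf
    rw [e1, e2]
    push_cast
    ring
  rw [e, Complex.re_ofReal_mul]
  refine mul_nonneg hR ?_
  rw [Complex.I_mul_re, Complex.add_im, Complex.im_ofReal_mul, Complex.im_ofReal_mul,
    Complex.exp_ofReal_mul_I_im, Complex.exp_ofReal_mul_I_im, Real.sin_neg]
  have := one_sub_mul_sin_le (β := α / 2) (by linarith) (by linarith) h3.le h4.le
  linarith

end Symbol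

/-! ### From the symbol to the quadratic form of `L`. -/

section ToeplitzForm

variable {α : ℝ} {m : ℕ}

theorem integral_weightSymbol_eq_grunwaldMatrix (h1 : 1 < α) (h2 : α < 2) (i j : Fin m) :
    ∫ θ in (0 : ℝ)..(2 * Real.pi), weightSymbol α θ * Complex.exp (-(θ * Complex.I)) *
      (Complex.exp (-(i * (θ * Complex.I))) * Complex.exp (j * (θ * Complex.I))) =
      -(2 * Real.pi * (grunwaldMatrix α m i j : ℂ)) := by
  have h := integral_weightSymbol_mul_exp h1 h2 ((i : ℤ) + 1 - j)
  have e : ∀ θ : ℝ, weightSymbol α θ * Complex.exp (-(θ * Complex.I)) *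
      (Complex.exp (-(i * (θ * Complex.I))) * Complex.exp (j * (θ * Complex.I))) =
      weightSymbol α θ * Complex.exp ((-((i : ℤ) + 1 - j) : ℤ) * (θ * Complex.I)) := by
    intro θ
    rw [mul_assoc, ← Complex.exp_add, ← Complex.exp_add]
    congr 2
    push_cast; ring
  simp only [e]
  rw [h]
  simp only [grunwaldMatrix, Matrix.of_apply]
  split_ifs with h3 h4 h4
  · have : ((i : ℤ) + 1 - j).toNat = (i : ℕ) + 1 - j := by omega
    rw [this]; push_cast; ring
  · omega
  · omega
  · simp

/-- For `x = u + i v` with trigonometric polynomial `X`, the Hermitian form of `L` at `x` is the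
mean of the symbol against `|X|²`. Its real part carries the symmetric part of `L` and its imaginary
part the skew part, so positivity of the rotated symbol passes to this combination. -/
theorem rotated_form_nonneg (h1 : 1 < α) (h2 : α < 2) (u v : Fin m → ℝ) :
    0 ≤ Real.sin (α / 2 * Real.pi) *
        (u ⬝ᵥ (grunwaldMatrix α m *ᵥ u) + v ⬝ᵥ (grunwaldMatrix α m *ᵥ v)) +
      Real.cos (α / 2 * Real.pi) *
        (u ⬝ᵥ (grunwaldMatrix α m *ᵥ v) - v ⬝ᵥ (grunwaldMatrix α m *ᵥ u)) := by
  set x : Fin m → ℂ := fun j => u j + v j * Complex.I with hx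
  set X : ℝ → ℂ := fun θ => ∑ j : Fin m, x j * Complex.exp (j * (θ * Complex.I)) with hX
  have hXc : Continuous X := by fun_prop
  have hconj : ∀ θ, (starRingEnd ℂ) (X θ) =
      ∑ i : Fin m, (starRingEnd ℂ) (x i) * Complex.exp (-(i * (θ * Complex.I))) := by
    intro θ
    simp only [hX, map_sum, map_mul, ← Complex.exp_conj, Complex.conj_ofReal, Complex.conj_I,
      map_natCast]
    refine Finset.sum_congr rfl fun i _ => ?_
    ring_nf
  set c : ℂ := Complex.I * Complex.exp (((α / 2 * Real.pi : ℝ) : ℂ) * Complex.I) with hc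
  have hfc : Continuous fun θ => weightSymbol α θ * Complex.exp (-(θ * Complex.I)) :=
    (continuous_weightSymbol h1 h2).mul (by fun_prop)
  have hint : ∫ θ in (0 : ℝ)..(2 * Real.pi),
      weightSymbol α θ * Complex.exp (-(θ * Complex.I)) * ((starRingEnd ℂ) (X θ) * X θ) =
      -(2 * Real.pi * ∑ i, ∑ j, (starRingEnd ℂ) (x i) * x j * (grunwaldMatrix α m i j : ℂ)) := by
    have e : ∀ θ : ℝ,
        weightSymbol α θ * Complex.exp (-(θ * Complex.I)) * ((starRingEnd ℂ) (X θ) * X θ) =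
        ∑ i : Fin m, ∑ j : Fin m, (starRingEnd ℂ) (x i) * x j *
          (weightSymbol α θ * Complex.exp (-(θ * Complex.I)) *
          (Complex.exp (-(i * (θ * Complex.I))) * Complex.exp (j * (θ * Complex.I)))) := by
      intro θ
      rw [hconj, hX, Finset.sum_mul_sum, Finset.mul_sum]
      refine Finset.sum_congr rfl fun i _ => ?_
      rw [Finset.mul_sum]
      exact Finset.sum_congr rfl fun j _ => by ring
    have hI : ∀ i j : Fin m, Continuous fun θ : ℝ => (starRingEnd ℂ) (x i) * x j *
          (weightSymbol α θ * Complex.exp (-(θ * Complex.I)) *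
          (Complex.exp (-(i * (θ * Complex.I))) * Complex.exp (j * (θ * Complex.I)))) :=
      fun i j => continuous_const.mul (hfc.mul (by fun_prop))
    simp only [e]
    rw [intervalIntegral.integral_finsetSum fun i _ =>
      (continuous_finsetSum _ fun j _ => hI i j).intervalIntegrable _ _, Finset.mul_sum,
      ← Finset.sum_neg_distrib]
    refine Finset.sum_congr rfl fun i _ => ?_
    rw [intervalIntegral.integral_finsetSum fun j _ => (hI i j).intervalIntegrable _ _,
      Finset.mul_sum, ← Finset.sum_neg_distrib]
    refine Finset.sum_congr rfl fun j _ => ?_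
    rw [intervalIntegral.integral_const_mul, integral_weightSymbol_eq_grunwaldMatrix h1 h2]
    ring
  have hform : ∑ i, ∑ j, (starRingEnd ℂ) (x i) * x j * (grunwaldMatrix α m i j : ℂ) =
      ((u ⬝ᵥ (grunwaldMatrix α m *ᵥ u) + v ⬝ᵥ (grunwaldMatrix α m *ᵥ v) : ℝ) : ℂ) +
      ((u ⬝ᵥ (grunwaldMatrix α m *ᵥ v) - v ⬝ᵥ (grunwaldMatrix α m *ᵥ u) : ℝ) : ℂ) *
        Complex.I := by
    simp only [dotProduct, mulVec, Finset.mul_sum, ← Finset.sum_add_distrib,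
      ← Finset.sum_sub_distrib]
    push_cast
    simp only [Finset.sum_mul, ← Finset.sum_add_distrib]
    refine Finset.sum_congr rfl fun i _ => Finset.sum_congr rfl fun j _ => ?_
    simp only [hx, map_add, map_mul, Complex.conj_ofReal, Complex.conj_I]
    linear_combination (-(v i : ℂ) * v j * grunwaldMatrix α m i j) * Complex.I_sq
  have hnn : 0 ≤ (∫ θ in (0 : ℝ)..(2 * Real.pi),
      c * (weightSymbol α θ * Complex.exp (-(θ * Complex.I)) *
        ((starRingEnd ℂ) (X θ) * X θ))).re := by
    have hcont : Continuous fun θ => c * (weightSymbol α θ * Complex.exp (-(θ * Complex.I)) *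
        ((starRingEnd ℂ) (X θ) * X θ)) :=
      continuous_const.mul (hfc.mul ((Complex.continuous_conj.comp hXc).mul hXc))
    have := Complex.reCLM.intervalIntegral_comp_comm
      (hcont.intervalIntegrable (μ := MeasureTheory.volume) 0 (2 * Real.pi))
    rw [Complex.reCLM_apply] at this
    rw [← this]
    refine intervalIntegral.integral_nonneg (by positivity) fun θ hθ => ?_
    rw [Complex.reCLM_apply, mul_comm ((starRingEnd ℂ) (X θ)), Complex.mul_conj, ← mul_assoc,
      Complex.re_mul_ofReal]
    exact mul_nonneg (rotated_symbol_re_nonneg h1 h2 hθ.1 hθ.2) (Complex.normSq_nonneg _)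
  rw [intervalIntegral.integral_const_mul, hint, hform] at hnn
  generalize u ⬝ᵥ (grunwaldMatrix α m *ᵥ u) + v ⬝ᵥ (grunwaldMatrix α m *ᵥ v) = p at *
  generalize u ⬝ᵥ (grunwaldMatrix α m *ᵥ v) - v ⬝ᵥ (grunwaldMatrix α m *ᵥ u) = q at *
  have hre : (c * -(2 * Real.pi * ((p : ℂ) + (q : ℂ) * Complex.I))).re =
      2 * Real.pi * (Real.sin (α / 2 * Real.pi) * p + Real.cos (α / 2 * Real.pi) * q) := by
    rw [hc, Complex.exp_mul_I, ← Complex.ofReal_cos, ← Complex.ofReal_sin]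
    generalize Real.sin (α / 2 * Real.pi) = s
    generalize Real.cos (α / 2 * Real.pi) = t
    simp
    ring
  rw [hre] at hnn
  exact (mul_nonneg_iff_of_pos_left (by positivity)).1 hnn

/-- The skew part of `L` is bounded by `|tan(απ/2)|` times its symmetric part. -/
theorem grunwaldMatrix_skew_form_le (h1 : 1 < α) (h2 : α < 2) (u v : Fin m → ℝ) :
    |u ⬝ᵥ (grunwaldMatrix α m *ᵥ v) - v ⬝ᵥ (grunwaldMatrix α m *ᵥ u)| ≤
      |Real.tan (α / 2 * Real.pi)| *
        (u ⬝ᵥ (grunwaldMatrix α m *ᵥ u) + v ⬝ᵥ (grunwaldMatrix α m *ᵥ v)) := by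
  have ha := rotated_form_nonneg h1 h2 u v
  -- Swapping `u` and `v` flips the sign of the skew term, which yields the absolute value.
  have hb := rotated_form_nonneg h1 h2 v u
  have hs : 0 < Real.sin (α / 2 * Real.pi) :=
    Real.sin_pos_of_pos_of_lt_pi (by nlinarith [Real.pi_pos]) (by nlinarith [Real.pi_pos])
  have hc : Real.cos (α / 2 * Real.pi) < 0 :=
    Real.cos_neg_of_pi_div_two_lt_of_lt (by nlinarith [Real.pi_pos]) (by nlinarith [Real.pi_pos])
  rw [Real.tan_eq_sin_div_cos, abs_div, abs_of_pos hs, abs_of_neg hc, div_mul_eq_mul_div,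
    le_div_iff₀ (by linarith)]
  rcases abs_cases (u ⬝ᵥ (grunwaldMatrix α m *ᵥ v) - v ⬝ᵥ (grunwaldMatrix α m *ᵥ u)) with h | h
  <;> rw [h.1] <;> linarith

end ToeplitzForm

/-! ### Polynomials small on two symmetric intervals. -/

section Chebyshev

-- The quadratic `q` maps both intervals into `[-1, 1]` and has `q(0) = cosh (log ρ)` with `ρ = (b +
-- a) / (b - a)`. Hence `T_j ∘ q` is bounded by `1` there and at least `ρ ^ j / 2` at `0`; dividing
-- by the latter value gives `p`.
open Polynomial in
theorem exists_polynomial_abs_le {a b : ℝ} (ha : 0 < a) (hab : a < b) (j : ℕ) :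
    ∃ p : ℝ[X], p.natDegree ≤ 2 * j ∧ p.eval 0 = 1 ∧
      ∀ x : ℝ, a ≤ |x| → |x| ≤ b → |p.eval x| ≤ 2 * ((b - a) / (b + a)) ^ j := by
  have hd : 0 < b ^ 2 - a ^ 2 := by nlinarith
  have hba : 0 < b - a := by linarith
  have hba' : 0 < b + a := by linarith
  set ρ := (b + a) / (b - a) with hρ
  have hρ0 : 0 < ρ := by positivity
  set q : ℝ[X] := C ((b ^ 2 + a ^ 2) / (b ^ 2 - a ^ 2)) - C (2 / (b ^ 2 - a ^ 2)) * X ^ 2 with hq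
  have hq0 : q.eval 0 = Real.cosh (Real.log ρ) := by
    rw [Real.cosh_eq, Real.exp_neg, Real.exp_log hρ0, hρ]
    simp [hq]
    have : b ^ 2 - a ^ 2 = (b - a) * (b + a) := by ring
    rw [this]
    field_simp
    ring
  have hT : ρ ^ j / 2 ≤ ((Chebyshev.T ℝ j).comp q).eval 0 := by
    rw [eval_comp, hq0, Chebyshev.T_real_cosh, Real.cosh_eq]
    have e : Real.exp ((j : ℤ) * Real.log ρ) = ρ ^ j := by
      rw [Int.cast_natCast, Real.exp_nat_mul, Real.exp_log hρ0]
    rw [e]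
    have := Real.exp_pos (-((j : ℤ) * Real.log ρ))
    linarith
  set t := ((Chebyshev.T ℝ j).comp q).eval 0 with ht
  have ht0 : 0 < t := lt_of_lt_of_le (by positivity) hT
  refine ⟨C t⁻¹ * (Chebyshev.T ℝ j).comp q, ?_, ?_, ?_⟩
  · refine (natDegree_C_mul_le _ _).trans ?_
    rw [natDegree_comp, Chebyshev.natDegree_T, Int.natAbs_natCast, mul_comm]
    refine Nat.mul_le_mul_right _ ?_
    rw [hq]
    compute_degree
  · rw [eval_mul, eval_C, ← ht, inv_mul_cancel₀ ht0.ne']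
  · intro x hx1 hx2
    have h1 : a ^ 2 ≤ x ^ 2 := by rw [← sq_abs x]; gcongr
    have h2 : x ^ 2 ≤ b ^ 2 := by rw [← sq_abs x]; gcongr
    have hqx : |q.eval x| ≤ 1 := by
      have e : q.eval x = (b ^ 2 + a ^ 2 - 2 * x ^ 2) / (b ^ 2 - a ^ 2) := by
        simp [hq]; ring
      rw [e, abs_div, abs_of_pos hd, div_le_one hd, abs_le]
      constructor <;> linarith
    have hTx := Chebyshev.abs_eval_T_real_le_one (j : ℤ) hqx
    rw [eval_mul, eval_C, abs_mul, abs_of_pos (inv_pos.2 ht0), eval_comp]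
    calc t⁻¹ * |eval (eval x q) (Chebyshev.T ℝ j)| ≤ (ρ ^ j / 2)⁻¹ * 1 := by gcongr
      _ = 2 * ((b - a) / (b + a)) ^ j := by
        rw [hρ, div_pow, div_pow]
        field_simp

end Chebyshev

/-! ### Symmetric-definite pencils and MINRES. -/

section Pencil

variable {ι : Type*} [Fintype ι] [DecidableEq ι]

open scoped MatrixOrder Matrix.Norms.L2Operator in
/-- Simultaneous diagonalization by congruence of a symmetric and a positive definite matrix. -/
theorem exists_simultaneous_diagonalization {M P : Matrix ι ι ℝ} (hM : M.IsSymm) (hP : P.PosDef) :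
    ∃ (V : Matrix ι ι ℝ) (l : ι → ℝ), IsUnit V ∧ P = Vᵀ * V ∧ M = Vᵀ * diagonal l * V := by
  -- Factor `P = Bᵀ B`, diagonalize the symmetric matrix `B⁻ᵀ M B⁻¹` by an orthogonal `U`, and take
  -- `V = Uᵀ B`.
  obtain ⟨B, hB⟩ := CStarAlgebra.nonneg_iff_eq_star_mul_self.mp hP.posSemidef.nonneg
  rw [Matrix.star_eq_conjTranspose, Matrix.conjTranspose_eq_transpose_of_trivial] at hB
  have hBu : IsUnit B := by
    have := hP.isUnit
    rw [hB, Matrix.isUnit_iff_isUnit_det, Matrix.det_mul] at this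
    exact (Matrix.isUnit_iff_isUnit_det _).2 (isUnit_of_mul_isUnit_right this)
  have hBd := (Matrix.isUnit_iff_isUnit_det _).1 hBu
  have hBB : B⁻¹ * B = 1 := Matrix.nonsing_inv_mul _ hBd
  have hBT : Bᵀ * (B⁻¹)ᵀ = 1 := by rw [← Matrix.transpose_mul, hBB, Matrix.transpose_one]
  have hN : ((B⁻¹)ᵀ * M * B⁻¹).IsHermitian := by
    rw [Matrix.IsHermitian, Matrix.conjTranspose_eq_transpose_of_trivial, Matrix.transpose_mul,
      Matrix.transpose_mul, Matrix.transpose_transpose, hM.eq, Matrix.mul_assoc]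
  have hs := hN.spectral_theorem
  set U : Matrix ι ι ℝ := (hN.eigenvectorUnitary : Matrix ι ι ℝ) with hU
  have hUU : U * Uᵀ = 1 := by
    have := Unitary.coe_mul_star_self hN.eigenvectorUnitary
    rwa [Unitary.coe_star, Matrix.star_eq_conjTranspose,
      Matrix.conjTranspose_eq_transpose_of_trivial] at this
  rw [Unitary.conjStarAlgAut_apply, Matrix.star_eq_conjTranspose,
    Matrix.conjTranspose_eq_transpose_of_trivial] at hs
  have hUu : IsUnit Uᵀ :=
    (Matrix.isUnit_iff_isUnit_det _).2 (Matrix.isUnit_det_of_left_inverse hUU)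
  refine ⟨Uᵀ * B, hN.eigenvalues, hUu.mul hBu, ?_, ?_⟩
  · rw [Matrix.transpose_mul, Matrix.transpose_transpose, hB, Matrix.mul_assoc,
      ← Matrix.mul_assoc U, hUU, Matrix.one_mul]
  · calc M = (Bᵀ * (B⁻¹)ᵀ) * M * (B⁻¹ * B) := by rw [hBT, hBB, Matrix.one_mul, Matrix.mul_one]
      _ = Bᵀ * ((B⁻¹)ᵀ * M * B⁻¹) * B := by simp only [Matrix.mul_assoc]
      _ = Bᵀ * (U * diagonal hN.eigenvalues * Uᵀ) * B :=
        congrArg (fun Z => Bᵀ * Z * B) hs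
      _ = _ := by
        rw [Matrix.transpose_mul, Matrix.transpose_transpose]; simp only [Matrix.mul_assoc]

/-- The columns of `V⁻¹` are eigenvectors of the pencil; thus hypotheses on eigenpairs apply to
every diagonal entry `l i`. -/
theorem mulVec_inv_single {V : Matrix ι ι ℝ} (hV : IsUnit V) (l : ι → ℝ) (i : ι) :
    V⁻¹ *ᵥ Pi.single i 1 ≠ 0 ∧ (Vᵀ * diagonal l * V) *ᵥ (V⁻¹ *ᵥ Pi.single i 1) =
      l i • ((Vᵀ * V) *ᵥ (V⁻¹ *ᵥ Pi.single i 1)) := by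
  have hVV : V * V⁻¹ = 1 := Matrix.mul_nonsing_inv _ ((Matrix.isUnit_iff_isUnit_det _).1 hV)
  constructor
  · intro h0
    have : V *ᵥ (V⁻¹ *ᵥ Pi.single i (1 : ℝ)) = 0 := by rw [h0, Matrix.mulVec_zero]
    rw [Matrix.mulVec_mulVec, hVV, Matrix.one_mulVec] at this
    simpa using congrFun this i
  · rw [Matrix.mulVec_mulVec, Matrix.mulVec_mulVec, Matrix.mul_assoc, hVV,
      Matrix.mul_one, Matrix.mul_assoc Vᵀ, hVV, Matrix.mul_one, ← Matrix.mulVec_mulVec,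
      ← Matrix.mulVec_smul]
    congr 1
    ext m
    by_cases hm : m = i
    · subst hm; simp [Matrix.mulVec_diagonal]
    · simp [Matrix.mulVec_diagonal, hm]

theorem precResidual_sub_sum (M P : Matrix ι ι ℝ) (c u₀ : ι → ℝ) (k : ℕ) (a : ℕ → ℝ) :
    precResidual M P c
        (u₀ - ∑ j ∈ Finset.range k, a j • ((P⁻¹ * M) ^ j *ᵥ precResidual M P c u₀)) =
      precResidual M P c u₀ +
        ∑ j ∈ Finset.range k, a j • ((P⁻¹ * M) ^ (j + 1) *ᵥ precResidual M P c u₀) := by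
  have h : ∀ u w, precResidual M P c (u - w) = precResidual M P c u + (P⁻¹ * M) *ᵥ w := by
    intro u w
    rw [precResidual, precResidual, Matrix.mulVec_sub]
    abel
  rw [h, Matrix.mulVec_sum]
  congr 1
  refine Finset.sum_congr rfl fun j _ => ?_
  rw [Matrix.mulVec_smul, Matrix.mulVec_mulVec, ← pow_succ']

variable {M P : Matrix ι ι ℝ}

theorem energyNorm_transpose_mul_self {ι : Type*} [Fintype ι] (V : Matrix ι ι ℝ) (z : ι → ℝ) :
    energyNorm (Vᵀ * V) z = √(∑ i, (V *ᵥ z) i ^ 2) := by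
  rw [energyNorm, ← Matrix.mulVec_mulVec, Matrix.dotProduct_mulVec, Matrix.vecMul_transpose]
  simp [dotProduct, sq]

theorem mulVec_pow_mulVec {V B : Matrix ι ι ℝ} {l : ι → ℝ} (h : V * B = diagonal l * V)
    (j : ℕ) (r : ι → ℝ) (i : ι) : (V *ᵥ (B ^ j *ᵥ r)) i = l i ^ j * (V *ᵥ r) i := by
  induction j generalizing r with
  | zero => simp
  | succ j ih =>
    rw [pow_succ, ← Matrix.mulVec_mulVec, ih, Matrix.mulVec_mulVec, h, ← Matrix.mulVec_mulVec,
      Matrix.mulVec_diagonal]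
    ring

/-- The optimality of MINRES in terms of residual polynomials. -/
theorem energyNorm_minres_le_of_polynomial (hM : M.IsSymm) (hP : P.PosDef) {c u₀ u : ι → ℝ}
    {k : ℕ} (hu : IsMinresIterate M P c u₀ k u) {p : Polynomial ℝ} (hp : p.natDegree ≤ k)
    (hp0 : p.eval 0 = 1) {K : ℝ} (hK : 0 ≤ K)
    (hpK : ∀ (l : ℝ) (x : ι → ℝ), x ≠ 0 → M *ᵥ x = l • (P *ᵥ x) → |p.eval l| ≤ K) :
    energyNorm P (precResidual M P c u) ≤ K * energyNorm P (precResidual M P c u₀) := by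
  obtain ⟨V, l, hV, hPV, hMV⟩ := exists_simultaneous_diagonalization hM hP
  have hVd := (Matrix.isUnit_iff_isUnit_det _).1 hV
  have hVV : V * V⁻¹ = 1 := Matrix.mul_nonsing_inv _ hVd
  have hVT : (Vᵀ)⁻¹ * Vᵀ = 1 := Matrix.nonsing_inv_mul _ (by rwa [Matrix.det_transpose])
  have hl : ∀ i, |p.eval (l i)| ≤ K := by
    intro i
    have h := mulVec_inv_single hV l i
    rw [← hMV, ← hPV] at h
    exact hpK (l i) _ h.1 h.2
  have hB : V * (P⁻¹ * M) = diagonal l * V := by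
    rw [hPV, hMV, Matrix.mul_inv_rev]
    calc V * (V⁻¹ * (Vᵀ)⁻¹ * (Vᵀ * diagonal l * V)) =
        (V * V⁻¹) * ((Vᵀ)⁻¹ * Vᵀ) * diagonal l * V := by simp only [Matrix.mul_assoc]
      _ = _ := by rw [hVV, hVT]; simp
  set B := P⁻¹ * M with hBdef
  set r := precResidual M P c u₀ with hr
  -- Since `p(0) = 1`, this competitor has residual `p(B) r`; the shifted coefficients keep the
  -- correction in the `k`-th Krylov space.
  set y : ι → ℝ := u₀ - ∑ j ∈ Finset.range k, p.coeff (j + 1) • (B ^ j *ᵥ r) with hy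
  have hmem : y - u₀ ∈ krylov B r k := by
    rw [hy, sub_sub_cancel_left]
    refine Submodule.neg_mem _ (Submodule.sum_mem _ fun j hj => Submodule.smul_mem _ _ ?_)
    exact Submodule.subset_span ⟨j, Finset.mem_range.1 hj, rfl⟩
  refine (hu.2 y hmem).trans ?_
  have hres : ∀ i, (V *ᵥ precResidual M P c y) i = p.eval (l i) * (V *ᵥ r) i := by
    intro i
    rw [hy, hr, precResidual_sub_sum, ← hr, ← hBdef, Matrix.mulVec_add, Matrix.mulVec_sum,
      Pi.add_apply, Finset.sum_apply,
      Polynomial.eval_eq_sum_range' (Nat.lt_succ_of_le hp), Finset.sum_range_succ',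
      Polynomial.coeff_zero_eq_eval_zero, hp0]
    simp only [Matrix.mulVec_smul, Pi.smul_apply, mulVec_pow_mulVec hB, smul_eq_mul, add_mul,
      Finset.sum_mul]
    simp only [pow_zero, mul_one, one_mul, mul_assoc, add_comm]
  rw [hPV, energyNorm_transpose_mul_self, energyNorm_transpose_mul_self, ← Real.sqrt_sq hK,
    ← Real.sqrt_mul (sq_nonneg K), ← hPV]
  refine Real.sqrt_le_sqrt ?_
  rw [Finset.mul_sum]
  refine Finset.sum_le_sum fun i _ => ?_
  rw [hres, mul_pow, ← sq_abs (p.eval (l i))]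
  gcongr
  exact hl i

/-- The convergence bound of MINRES for spectra in `[-b, -a] ∪ [a, b]`. -/
theorem energyNorm_minres_le (hM : M.IsSymm) (hP : P.PosDef) {c u₀ u : ι → ℝ} {k : ℕ}
    (hu : IsMinresIterate M P c u₀ k u) {a b : ℝ} (ha : 0 < a) (hab : a < b)
    (h : ∀ (l : ℝ) (x : ι → ℝ), x ≠ 0 → M *ᵥ x = l • (P *ᵥ x) → a ≤ |l| ∧ |l| ≤ b) :
    energyNorm P (precResidual M P c u) ≤
      2 * ((b - a) / (b + a)) ^ (k / 2) * energyNorm P (precResidual M P c u₀) := by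
  obtain ⟨p, hp, hp0, hpb⟩ := exists_polynomial_abs_le ha hab (k / 2)
  refine energyNorm_minres_le_of_polynomial hM hP hu (hp.trans (Nat.mul_div_le k 2)) hp0 ?_
    fun l x hx hl => hpb l (h l x hx hl).1 (h l x hx hl).2
  have : 0 ≤ b - a := by linarith
  have : 0 ≤ b + a := by linarith
  positivity

/-- The complex spectrum of `P⁻¹ M` consists of real generalized eigenvalues. -/
theorem exists_real_eigenvector (hM : M.IsSymm) (hP : P.PosDef) {z : ℂ}
    (hz : z ∈ spectrum ℂ ((P⁻¹ * M).map (algebraMap ℝ ℂ))) :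
    ∃ (l : ℝ) (x : ι → ℝ), z = (l : ℂ) ∧ x ≠ 0 ∧ M *ᵥ x = l • (P *ᵥ x) := by
  obtain ⟨V, l, hV, hPV, hMV⟩ := exists_simultaneous_diagonalization hM hP
  have hVd := (Matrix.isUnit_iff_isUnit_det _).1 hV
  have hVV : V * V⁻¹ = 1 := Matrix.mul_nonsing_inv _ hVd
  have hVT : (Vᵀ)⁻¹ * Vᵀ = 1 := Matrix.nonsing_inv_mul _ (by rwa [Matrix.det_transpose])
  have hB : P⁻¹ * M = V⁻¹ * diagonal l * V := by
    rw [hPV, hMV, Matrix.mul_inv_rev]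
    calc V⁻¹ * (Vᵀ)⁻¹ * (Vᵀ * diagonal l * V) =
        V⁻¹ * ((Vᵀ)⁻¹ * Vᵀ) * diagonal l * V := by simp only [Matrix.mul_assoc]
      _ = _ := by rw [hVT]; simp
  have hmem : ∃ i, z = (l i : ℂ) := by
    -- If `z` avoids every `l i`, then `z - P⁻¹ M` is similar to an invertible diagonal matrix.
    by_contra! hne
    rw [spectrum.mem_iff] at hz
    apply hz
    have e : algebraMap ℂ (Matrix ι ι ℂ) z - (P⁻¹ * M).map (algebraMap ℝ ℂ) =
        (V⁻¹).map (algebraMap ℝ ℂ) * diagonal (fun i => z - l i) * V.map (algebraMap ℝ ℂ) := by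
      have e1 : diagonal (fun i => z - (l i : ℂ)) =
          algebraMap ℂ (Matrix ι ι ℂ) z - (diagonal l).map (algebraMap ℝ ℂ) := by
        rw [Matrix.algebraMap_eq_diagonal, Matrix.diagonal_map (map_zero _), Matrix.diagonal_sub]
        rfl
      have hVV' : (V⁻¹).map (algebraMap ℝ ℂ) * V.map (algebraMap ℝ ℂ) = 1 := by
        rw [← Matrix.map_mul, Matrix.nonsing_inv_mul _ hVd,
          Matrix.map_one _ (map_zero _) (map_one _)]
      rw [e1, Matrix.mul_sub, Matrix.sub_mul, ← Algebra.commutes, Matrix.mul_assoc, hVV',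
        Matrix.mul_one, hB, Matrix.map_mul, Matrix.map_mul]
    rw [e]
    have hVm : IsUnit (V.map (algebraMap ℝ ℂ)) :=
      hV.map (RingHom.mapMatrix (algebraMap ℝ ℂ))
    have hVm' : IsUnit ((V⁻¹).map (algebraMap ℝ ℂ)) :=
      (Matrix.isUnit_nonsing_inv_iff.2 hV).map (RingHom.mapMatrix (algebraMap ℝ ℂ))
    refine (hVm'.mul ?_).mul hVm
    rw [Matrix.isUnit_diagonal, Pi.isUnit_iff]
    exact fun i => (sub_ne_zero.2 (hne i)).isUnit
  obtain ⟨i, hi⟩ := hmem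
  have h := mulVec_inv_single hV l i
  rw [← hMV, ← hPV] at h
  exact ⟨l i, _, hi, h.1, h.2⟩

end Pencil

/-! ### Forms with a dominated skew part, and eigenvalue localization. -/

section SkewPerturbation

variable {ι : Type*} [Fintype ι]

theorem dotProduct_mulVec_swap (M : Matrix ι ι ℝ) (u v : ι → ℝ) :
    u ⬝ᵥ (Mᵀ *ᵥ v) = v ⬝ᵥ (M *ᵥ u) := by
  rw [Matrix.mulVec_transpose, dotProduct_comm, ← Matrix.dotProduct_mulVec]

theorem form_smul_add (M : Matrix ι ι ℝ) (t : ℝ) (u v : ι → ℝ) :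
    (t • u + v) ⬝ᵥ (M *ᵥ (t • u + v)) = t ^ 2 * (u ⬝ᵥ (M *ᵥ u)) +
      t * (u ⬝ᵥ (M *ᵥ v) + v ⬝ᵥ (M *ᵥ u)) + v ⬝ᵥ (M *ᵥ v) := by
  simp only [Matrix.mulVec_add, Matrix.mulVec_smul, dotProduct_add, add_dotProduct,
    dotProduct_smul, smul_dotProduct, smul_eq_mul]
  ring

/-- Cauchy–Schwarz in weighted additive form: evaluate the form at `± t u + v`. -/
theorem two_mul_abs_form_le {M : Matrix ι ι ℝ} (hM : M.IsSymm)
    (h : ∀ x : ι → ℝ, 0 ≤ x ⬝ᵥ (M *ᵥ x)) (t : ℝ) (u v : ι → ℝ) :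
    2 * t * |u ⬝ᵥ (M *ᵥ v)| ≤ t ^ 2 * (u ⬝ᵥ (M *ᵥ u)) + v ⬝ᵥ (M *ᵥ v) := by
  have hs : v ⬝ᵥ (M *ᵥ u) = u ⬝ᵥ (M *ᵥ v) := by
    rw [← dotProduct_mulVec_swap, hM.eq]
  have h1 := h (t • u + v)
  have h2 := h ((-t) • u + v)
  rw [form_smul_add, hs] at h1 h2
  rcases abs_cases (u ⬝ᵥ (M *ᵥ v)) with h3 | h3 <;> rw [h3.1] <;> nlinarith

variable [DecidableEq ι]

/-- If the symmetric part of `A` is positive definite and dominates the skew part with constant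
`μ`, then `A` is bounded by `√(1 + μ²)` in the energy of its symmetric part. -/
theorem abs_form_le_of_skew_le {A : Matrix ι ι ℝ} {μ : ℝ} (hμ : 0 ≤ μ)
    (hpos : ∀ x : ι → ℝ, x ≠ 0 → 0 < x ⬝ᵥ (A *ᵥ x))
    (hskew : ∀ u v : ι → ℝ, |u ⬝ᵥ (A *ᵥ v) - v ⬝ᵥ (A *ᵥ u)| ≤
      μ * (u ⬝ᵥ (A *ᵥ u) + v ⬝ᵥ (A *ᵥ v))) (y x : ι → ℝ) :
    2 * √(1 + μ ^ 2) * |y ⬝ᵥ (A *ᵥ x)| ≤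
      (1 + μ ^ 2) * (y ⬝ᵥ (A *ᵥ y) + x ⬝ᵥ (A *ᵥ x)) := by
  set H : Matrix ι ι ℝ := (1 / 2 : ℝ) • (A + Aᵀ) with hH
  set S : Matrix ι ι ℝ := (1 / 2 : ℝ) • (A - Aᵀ) with hS
  have hAHS : A = H + S := by
    ext i j; simp [hH, hS]; ring
  have hHsymm : H.IsSymm := by simp [Matrix.IsSymm, hH, add_comm]
  have hHform : ∀ u, u ⬝ᵥ (H *ᵥ u) = u ⬝ᵥ (A *ᵥ u) := by
    intro u
    rw [hH, Matrix.smul_mulVec, Matrix.add_mulVec, dotProduct_smul, dotProduct_add,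
      dotProduct_mulVec_swap, smul_eq_mul]
    ring
  have hSform : ∀ u v, u ⬝ᵥ (S *ᵥ v) = (u ⬝ᵥ (A *ᵥ v) - v ⬝ᵥ (A *ᵥ u)) / 2 := by
    intro u v
    rw [hS, Matrix.smul_mulVec, Matrix.sub_mulVec, dotProduct_smul, dotProduct_sub,
      dotProduct_mulVec_swap, smul_eq_mul]
    ring
  have hHpos : H.PosDef := by
    refine Matrix.PosDef.of_dotProduct_mulVec_pos ?_ fun x hx => ?_
    · rwa [Matrix.IsHermitian, Matrix.conjTranspose_eq_transpose_of_trivial]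
    · simpa [hHform] using hpos x hx
  have hnn : ∀ u : ι → ℝ, 0 ≤ u ⬝ᵥ (H *ᵥ u) := fun u => by
    simpa using hHpos.posSemidef.dotProduct_mulVec_nonneg u
  -- With this `w`, `A x = H (x + w)`, and `w` is `H`-orthogonal to `x` because `S` is skew.
  -- Pythagoras then produces the factor `1 + μ²` from `‖w‖_H ≤ μ ‖x‖_H`.
  set w := H⁻¹ *ᵥ (S *ᵥ x) with hw
  have hHw : H *ᵥ w = S *ᵥ x := by
    rw [hw, Matrix.mulVec_mulVec,
      Matrix.mul_nonsing_inv _ ((Matrix.isUnit_iff_isUnit_det _).1 hHpos.isUnit),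
      Matrix.one_mulVec]
  have hAx : A *ᵥ x = H *ᵥ (x + w) := by
    rw [Matrix.mulVec_add, hHw, hAHS, Matrix.add_mulVec]
  have hxw : x ⬝ᵥ (H *ᵥ w) = 0 := by rw [hHw, hSform, sub_self, zero_div]
  have hwx : w ⬝ᵥ (H *ᵥ x) = 0 := by rw [← dotProduct_mulVec_swap, hHsymm.eq, hxw]
  -- Scaling `x` by `t` leaves a free parameter in the skew bound. The choice `t = μ` is optimal;
  -- for `μ = 0` it is vacuous, and `t = 1` is used.
  have hww : ∀ t, 2 * t * (w ⬝ᵥ (H *ᵥ w)) ≤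
      μ * (t ^ 2 * (x ⬝ᵥ (H *ᵥ x)) + w ⬝ᵥ (H *ᵥ w)) := by
    intro t
    have h := (le_abs_self _).trans (hskew w (t • x))
    have e : w ⬝ᵥ (H *ᵥ w) = (w ⬝ᵥ (A *ᵥ x) - x ⬝ᵥ (A *ᵥ w)) / 2 := by rw [hHw, hSform]
    simp only [Matrix.mulVec_smul, dotProduct_smul, smul_dotProduct, smul_eq_mul, ← hHform] at h
    have e2 : 2 * t * (w ⬝ᵥ (H *ᵥ w)) = t * (w ⬝ᵥ (A *ᵥ x)) - t * (x ⬝ᵥ (A *ᵥ w)) := by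
      rw [e]; ring
    rw [e2]
    refine h.trans (le_of_eq (by ring))
  have hwle : w ⬝ᵥ (H *ᵥ w) ≤ μ ^ 2 * (x ⬝ᵥ (H *ᵥ x)) := by
    rcases hμ.eq_or_lt with h0 | h0
    · have := hww 1
      rw [← h0] at this ⊢
      linarith
    · have h := hww μ
      have : μ * (w ⬝ᵥ (H *ᵥ w)) ≤ μ * (μ ^ 2 * (x ⬝ᵥ (H *ᵥ x))) := by linarith
      exact le_of_mul_le_mul_left this h0
  have hz : (x + w) ⬝ᵥ (H *ᵥ (x + w)) ≤ (1 + μ ^ 2) * (x ⬝ᵥ (H *ᵥ x)) := by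
    have := form_smul_add H 1 x w
    rw [one_smul, hxw, hwx] at this
    rw [this]
    linarith
  have h := two_mul_abs_form_le hHsymm hnn (√(1 + μ ^ 2)) y (x + w)
  rw [Real.sq_sqrt (by positivity), ← hAx] at h
  rw [← hAx] at hz
  rw [← hHform y, ← hHform x]
  linarith

/-- Localization of the generalized eigenvalues of `Y A x = l P x` for an involution `Y` that
commutes with `P`. -/
theorem eigenvalue_bounds {A P Y : Matrix ι ι ℝ} {μ : ℝ} (hμ : 0 ≤ μ) (hP : P.PosDef)
    (hY : Y.IsSymm) (hYY : Y * Y = 1) (hYP : Y * P = P * Y)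
    (hlow : ∀ x : ι → ℝ, x ≠ 0 → 1 / 2 * (x ⬝ᵥ (P *ᵥ x)) < x ⬝ᵥ (A *ᵥ x))
    (hup : ∀ x : ι → ℝ, x ≠ 0 → x ⬝ᵥ (A *ᵥ x) < 3 / 2 * (x ⬝ᵥ (P *ᵥ x)))
    (hskew : ∀ u v : ι → ℝ, |u ⬝ᵥ (A *ᵥ v) - v ⬝ᵥ (A *ᵥ u)| ≤
      μ * (u ⬝ᵥ (A *ᵥ u) + v ⬝ᵥ (A *ᵥ v)))
    {l : ℝ} {x : ι → ℝ} (hx : x ≠ 0) (hl : (Y * A) *ᵥ x = l • (P *ᵥ x)) :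
    1 / 2 < |l| ∧ |l| < 3 / 2 * √(1 + μ ^ 2) := by
  have hPpos : ∀ x : ι → ℝ, x ≠ 0 → 0 < x ⬝ᵥ (P *ᵥ x) := fun x hx => by
    simpa using hP.dotProduct_mulVec_pos hx
  have hPnn : ∀ x : ι → ℝ, 0 ≤ x ⬝ᵥ (P *ᵥ x) := fun x => by
    simpa using hP.posSemidef.dotProduct_mulVec_nonneg x
  have hPsymm : P.IsSymm := by
    have := hP.isHermitian
    rwa [Matrix.IsHermitian, Matrix.conjTranspose_eq_transpose_of_trivial] at this
  have hxp := hPpos x hx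
  have hYx : Y *ᵥ (Y *ᵥ x) = x := by rw [Matrix.mulVec_mulVec, hYY, Matrix.one_mulVec]
  have hy0 : Y *ᵥ x ≠ 0 := fun h => hx (by rw [← hYx, h, Matrix.mulVec_zero])
  -- `Y` is moved across `P`, so that the lower bound tests with `x` and the upper bound with `Y x`,
  -- two vectors of equal `P`-energy.
  have hAx : A *ᵥ x = l • (P *ᵥ (Y *ᵥ x)) := by
    have : Y *ᵥ ((Y * A) *ᵥ x) = A *ᵥ x := by
      rw [Matrix.mulVec_mulVec, ← Matrix.mul_assoc, hYY, Matrix.one_mul]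
    rw [← this, hl, Matrix.mulVec_smul, Matrix.mulVec_mulVec, hYP, ← Matrix.mulVec_mulVec]
  have hyy : (Y *ᵥ x) ⬝ᵥ (P *ᵥ (Y *ᵥ x)) = x ⬝ᵥ (P *ᵥ x) := by
    rw [Matrix.mulVec_mulVec, ← hYP, ← Matrix.mulVec_mulVec, ← dotProduct_mulVec_swap, hY.eq,
      hYx, dotProduct_comm]
  constructor
  · have h1 := hlow x hx
    have h2 := two_mul_abs_form_le hPsymm hPnn 1 x (Y *ᵥ x)
    rw [hyy] at h2
    rw [hAx, dotProduct_smul, smul_eq_mul] at h1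
    have h3 : l * (x ⬝ᵥ (P *ᵥ (Y *ᵥ x))) ≤ |l| * (x ⬝ᵥ (P *ᵥ x)) := by
      refine (le_abs_self _).trans ?_
      rw [abs_mul]
      exact mul_le_mul_of_nonneg_left (by linarith) (abs_nonneg _)
    exact lt_of_mul_lt_mul_right (h1.trans_le h3) hxp.le
  · have hpos : ∀ x : ι → ℝ, x ≠ 0 → 0 < x ⬝ᵥ (A *ᵥ x) := fun x hx =>
      lt_of_le_of_lt (by linarith [hPnn x]) (hlow x hx)
    have h1 := abs_form_le_of_skew_le hμ hpos hskew (Y *ᵥ x) x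
    have h2 := hup x hx
    have h3 := hup _ hy0
    rw [hyy] at h3
    rw [hAx, dotProduct_smul, smul_eq_mul, hyy, abs_mul, abs_of_pos hxp, ← hAx] at h1
    have hs : 0 < √(1 + μ ^ 2) := Real.sqrt_pos.2 (by positivity)
    have hs2 : √(1 + μ ^ 2) ^ 2 = 1 + μ ^ 2 := Real.sq_sqrt (by positivity)
    set s := √(1 + μ ^ 2)
    rw [← hs2] at h1
    have h4 : s ^ 2 * ((Y *ᵥ x) ⬝ᵥ (A *ᵥ (Y *ᵥ x)) + x ⬝ᵥ (A *ᵥ x)) <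
        s ^ 2 * (3 * (x ⬝ᵥ (P *ᵥ x))) :=
      mul_lt_mul_of_pos_left (by linarith) (by positivity)
    have h5 : (2 * s * (x ⬝ᵥ (P *ᵥ x))) * |l| < (2 * s * (x ⬝ᵥ (P *ᵥ x))) * (3 / 2 * s) := by
      nlinarith
    exact lt_of_mul_lt_mul_left h5 (by positivity)

end SkewPerturbation

/-! ### Matrices acting along one axis of the grid, and index reversal. -/

section Kronecker

variable {d : ℕ} {n : Fin d → ℕ}

theorem axisMatrix_mulVec (i : Fin d) (L : Matrix (Fin (n i)) (Fin (n i)) ℝ) (v : Grid n → ℝ)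
    (x : Grid n) :
    (axisMatrix n i L *ᵥ v) x = ∑ k, L (x i) k * v (Function.update x i k) := by
  have hprod : ∀ y : Grid n, axisMatrix n i L x y =
      L (x i) (y i) * ∏ j ∈ Finset.univ.erase i, if x j = y j then 1 else 0 := by
    intro y
    simp only [axisMatrix, kron, Matrix.of_apply]
    rw [← Finset.mul_prod_erase _ _ (Finset.mem_univ i), Function.update_self]
    congr 1
    refine Finset.prod_congr rfl fun j hj => ?_
    rw [Function.update_of_ne (Finset.ne_of_mem_erase hj), Matrix.one_apply]
  rw [Matrix.mulVec, dotProduct]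
  symm
  refine Finset.sum_of_injOn (fun k => Function.update x i k)
    (fun a _ b _ h => by simpa using congrFun h i) (fun _ _ => Finset.mem_coe.2 (Finset.mem_univ _))
    (fun y _ hy => ?_) (fun k _ => ?_)
  · have hne : ∃ j, j ≠ i ∧ x j ≠ y j := by
      by_contra! h
      refine hy ⟨y i, by simp, ?_⟩
      ext j
      by_cases hj : j = i
      · subst hj; simp
      · simp [Function.update_of_ne hj, h j hj]
    obtain ⟨j, hj, hxy⟩ := hne
    rw [hprod, Finset.prod_eq_zero (Finset.mem_erase.2 ⟨hj, Finset.mem_univ j⟩) (if_neg hxy),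
      mul_zero, zero_mul]
  · rw [hprod, Function.update_self, Finset.prod_eq_one, mul_one]
    intro j hj
    rw [Function.update_of_ne (Finset.ne_of_mem_erase hj), if_pos rfl]

theorem sum_sum_update (i : Fin d) (F : Grid n → ℝ) :
    ∑ x : Grid n, ∑ k, F (Function.update x i k) = n i * ∑ x, F x := by
  -- Exchanging the `i`-th coordinate with the free index is an involution; it shows that every grid
  -- point is counted `n i` times.
  let e : Grid n × Fin (n i) → Grid n × Fin (n i) := fun p => (Function.update p.1 i p.2, p.1 i)
  have he : Function.Involutive e := by
    rintro ⟨x, k⟩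
    simp [e]
  rw [← Fintype.sum_prod_type' (f := fun x k => F (Function.update x i k))]
  rw [show (∑ p : Grid n × Fin (n i), F (Function.update p.1 i p.2)) =
    ∑ p : Grid n × Fin (n i), F p.1 from
      Equiv.sum_comp he.toPerm (fun p : Grid n × Fin (n i) => F p.1)]
  rw [Fintype.sum_prod_type]
  simp [Finset.mul_sum]

/-- A form along an axis is an average of one-dimensional forms over the grid lines. -/
theorem card_mul_axis_form (i : Fin d) (L : Matrix (Fin (n i)) (Fin (n i)) ℝ) (u v : Grid n → ℝ) :
    (n i : ℝ) * (u ⬝ᵥ (axisMatrix n i L *ᵥ v)) =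
      ∑ x : Grid n, (fun k => u (Function.update x i k)) ⬝ᵥ
        (L *ᵥ fun k => v (Function.update x i k)) := by
  rw [dotProduct, ← sum_sum_update]
  refine Finset.sum_congr rfl fun x _ => Finset.sum_congr rfl fun k _ => ?_
  rw [axisMatrix_mulVec]
  simp [mulVec, dotProduct]

theorem kron_rev_rev {M N : (i : Fin d) → Matrix (Fin (n i)) (Fin (n i)) ℝ}
    (h : ∀ i a b, M i (Fin.rev a) (Fin.rev b) = N i a b) (x y : Grid n) :
    kron M (fun i => (x i).rev) (fun i => (y i).rev) = kron N x y := by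
  simp [kron, h]

theorem axisMatrix_rev_rev (i : Fin d) {L L' : Matrix (Fin (n i)) (Fin (n i)) ℝ}
    (h : ∀ a b, L (Fin.rev a) (Fin.rev b) = L' a b) (x y : Grid n) :
    axisMatrix n i L (fun i => (x i).rev) (fun i => (y i).rev) = axisMatrix n i L' x y := by
  refine kron_rev_rev (fun j a b => ?_) x y
  by_cases hj : j = i
  · subst hj; simpa using h a b
  · simp [Function.update_of_ne hj, Matrix.one_apply]

theorem axisMatrix_transpose (i : Fin d) (L : Matrix (Fin (n i)) (Fin (n i)) ℝ) :
    (axisMatrix n i L)ᵀ = axisMatrix n i Lᵀ := by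
  ext x y
  simp only [axisMatrix, kron, Matrix.transpose_apply, Matrix.of_apply]
  refine Finset.prod_congr rfl fun j _ => ?_
  by_cases hj : j = i
  · subst hj; simp
  · simp [Function.update_of_ne hj, Matrix.one_apply, eq_comm]

theorem multiAntiIdentity_apply (x y : Grid n) :
    multiAntiIdentity n x y = if (fun i => (x i).rev) = y then 1 else 0 := by
  have h : ∀ i, antiIdentity (n i) (x i) (y i) = if (x i).rev = y i then (1 : ℝ) else 0 := by
    intro i
    simp only [antiIdentity, Matrix.of_apply, Fin.ext_iff, Fin.val_rev]
    have := (x i).2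
    have := (y i).2
    split_ifs <;> first | rfl | omega
  simp only [multiAntiIdentity, kron, Matrix.of_apply, h, funext_iff]
  by_cases hxy : ∀ i, (x i).rev = y i
  · simp [hxy]
  · rw [if_neg hxy]
    push Not at hxy
    obtain ⟨i, hi⟩ := hxy
    exact Finset.prod_eq_zero (Finset.mem_univ i) (if_neg hi)

theorem multiAntiIdentity_mul_apply (M : Matrix (Grid n) (Grid n) ℝ) (x y : Grid n) :
    (multiAntiIdentity n * M) x y = M (fun i => (x i).rev) y := by
  simp [Matrix.mul_apply, multiAntiIdentity_apply]

theorem multiAntiIdentity_isSymm : (multiAntiIdentity n).IsSymm := by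
  ext x y
  simp only [Matrix.transpose_apply, multiAntiIdentity_apply]
  congr 1
  rw [eq_iff_iff]
  constructor <;> (rintro rfl; simp)

theorem mul_multiAntiIdentity_apply (M : Matrix (Grid n) (Grid n) ℝ) (x y : Grid n) :
    (M * multiAntiIdentity n) x y = M x (fun i => (y i).rev) := by
  rw [← Matrix.transpose_apply (M * _), Matrix.transpose_mul, multiAntiIdentity_isSymm.eq,
    multiAntiIdentity_mul_apply, Matrix.transpose_apply]

theorem multiAntiIdentity_mul_self : multiAntiIdentity n * multiAntiIdentity n = 1 := by
  ext x y
  rw [multiAntiIdentity_mul_apply, multiAntiIdentity_apply, Matrix.one_apply]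
  simp

theorem one_rev_rev (x y : Grid n) :
    (1 : Matrix (Grid n) (Grid n) ℝ) (fun i => (x i).rev) (fun i => (y i).rev) =
      (1 : Matrix (Grid n) (Grid n) ℝ) x y := by
  simp [Matrix.one_apply, funext_iff]

end Kronecker

/-! ### The discretized system and its preconditioner. -/

section System

variable {d : ℕ} {n : Fin d → ℕ} {ν : ℝ} {α dp dm a b : Fin d → ℝ}

/-- Each `L` is persymmetric, so reversing all indices transposes `A`; this is what makes `Y A`
symmetric. -/
theorem systemMatrix_rev_rev (x y : Grid n) :
    systemMatrix ν α dp dm a b n (fun i => (x i).rev) (fun i => (y i).rev) =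
      systemMatrix ν α dp dm a b n y x := by
  simp only [systemMatrix, Matrix.add_apply, Matrix.smul_apply, Matrix.sum_apply, one_rev_rev,
    axisMatrix_transpose]
  congr 1
  · simp [Matrix.one_apply, eq_comm]
  · refine Finset.sum_congr rfl fun i _ => ?_
    rw [axisMatrix_rev_rev i (L' := (grunwaldMatrix (α i) (n i))ᵀ)
        (fun a b => grunwaldMatrix_rev (α i) a b),
      axisMatrix_rev_rev i (L' := grunwaldMatrix (α i) (n i))
        (fun a b => grunwaldMatrix_rev (α i) b a),
      ← axisMatrix_transpose]
    rfl

theorem multiAntiIdentity_mul_systemMatrix_isSymm :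
    (multiAntiIdentity n * systemMatrix ν α dp dm a b n).IsSymm := by
  ext x y
  rw [Matrix.transpose_apply, multiAntiIdentity_mul_apply, multiAntiIdentity_mul_apply,
    ← systemMatrix_rev_rev]
  simp

theorem tauPreconditioner_isSymm : (tauPreconditioner ν α dp dm a b n).IsSymm := by
  simp only [Matrix.IsSymm, tauPreconditioner, Matrix.transpose_add, Matrix.transpose_smul,
    Matrix.transpose_one, Matrix.transpose_sum, axisMatrix_transpose,
    (tauMatrix_symPart_isSymm _).eq]

theorem multiAntiIdentity_mul_tauPreconditioner :
    multiAntiIdentity n * tauPreconditioner ν α dp dm a b n =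
      tauPreconditioner ν α dp dm a b n * multiAntiIdentity n := by
  have h : ∀ x y : Grid n, tauPreconditioner ν α dp dm a b n (fun i => (x i).rev)
      (fun i => (y i).rev) = tauPreconditioner ν α dp dm a b n x y := by
    intro x y
    simp only [tauPreconditioner, Matrix.add_apply, Matrix.smul_apply, Matrix.sum_apply,
      one_rev_rev]
    congr 1
    refine Finset.sum_congr rfl fun i _ => ?_
    rw [axisMatrix_rev_rev i (fun a b => tauMatrix_rev (α i) a b)]
  ext x y
  rw [multiAntiIdentity_mul_apply, mul_multiAntiIdentity_apply, ← h x]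
  simp

theorem systemMatrix_form (u v : Grid n → ℝ) :
    u ⬝ᵥ (systemMatrix ν α dp dm a b n *ᵥ v) = ν * (u ⬝ᵥ v) +
      ∑ i, (scaledCoeff (dp i) (α i) (a i) (b i) (n i) *
          (u ⬝ᵥ (axisMatrix n i (grunwaldMatrix (α i) (n i)) *ᵥ v)) +
        scaledCoeff (dm i) (α i) (a i) (b i) (n i) *
          (v ⬝ᵥ (axisMatrix n i (grunwaldMatrix (α i) (n i)) *ᵥ u))) := by
  simp only [systemMatrix, Matrix.add_mulVec, Matrix.smul_mulVec, Matrix.one_mulVec,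
    Matrix.sum_mulVec, dotProduct_add, dotProduct_smul, dotProduct_sum, smul_eq_mul,
    dotProduct_mulVec_swap]

theorem tauPreconditioner_form (u v : Grid n → ℝ) :
    u ⬝ᵥ (tauPreconditioner ν α dp dm a b n *ᵥ v) = ν * (u ⬝ᵥ v) +
      ∑ i, (scaledCoeff (dp i) (α i) (a i) (b i) (n i) +
          scaledCoeff (dm i) (α i) (a i) (b i) (n i)) *
        (u ⬝ᵥ (axisMatrix n i (tauMatrix (symPart (grunwaldMatrix (α i) (n i)))) *ᵥ v)) := by
  simp only [tauPreconditioner, Matrix.add_mulVec, Matrix.smul_mulVec, Matrix.one_mulVec,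
    Matrix.sum_mulVec, dotProduct_add, dotProduct_smul, dotProduct_sum, smul_eq_mul]

theorem symPart_form {m : ℕ} (L : Matrix (Fin m) (Fin m) ℝ) (x : Fin m → ℝ) :
    x ⬝ᵥ (symPart L *ᵥ x) = x ⬝ᵥ (L *ᵥ x) := by
  rw [symPart, Matrix.smul_mulVec, Matrix.add_mulVec, dotProduct_smul, dotProduct_add,
    dotProduct_mulVec_swap, smul_eq_mul]
  ring

theorem axis_tau_form_bounds (hα : ∀ i, 1 < α i ∧ α i < 2) (hn : ∀ i, 1 ≤ n i) (i : Fin d)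
    (u : Grid n → ℝ) :
    0 ≤ u ⬝ᵥ (axisMatrix n i (tauMatrix (symPart (grunwaldMatrix (α i) (n i)))) *ᵥ u) ∧
    1 / 2 * (u ⬝ᵥ (axisMatrix n i (tauMatrix (symPart (grunwaldMatrix (α i) (n i)))) *ᵥ u)) ≤
      u ⬝ᵥ (axisMatrix n i (grunwaldMatrix (α i) (n i)) *ᵥ u) ∧
    u ⬝ᵥ (axisMatrix n i (grunwaldMatrix (α i) (n i)) *ᵥ u) ≤
      3 / 2 * (u ⬝ᵥ (axisMatrix n i (tauMatrix (symPart (grunwaldMatrix (α i) (n i)))) *ᵥ u)) := by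
  have hni : (0 : ℝ) < n i := by exact_mod_cast hn i
  have h := fun x => tauMatrix_form_bounds (m := n i) (hα i).1 (hα i).2 x
  simp only [symPart_form] at h
  refine ⟨?_, ?_, ?_⟩ <;> refine le_of_mul_le_mul_left ?_ hni
  · rw [card_mul_axis_form, mul_zero]
    exact Finset.sum_nonneg fun x _ => (h _).1
  · rw [mul_left_comm, card_mul_axis_form, card_mul_axis_form, Finset.mul_sum]
    exact Finset.sum_le_sum fun x _ => (h _).2.1
  · rw [mul_left_comm, card_mul_axis_form, card_mul_axis_form, Finset.mul_sum]
    exact Finset.sum_le_sum fun x _ => (h _).2.2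

theorem axis_skew_form_le (hα : ∀ i, 1 < α i ∧ α i < 2) (hn : ∀ i, 1 ≤ n i) (i : Fin d)
    (u v : Grid n → ℝ) :
    |u ⬝ᵥ (axisMatrix n i (grunwaldMatrix (α i) (n i)) *ᵥ v) -
        v ⬝ᵥ (axisMatrix n i (grunwaldMatrix (α i) (n i)) *ᵥ u)| ≤
      |Real.tan (α i / 2 * Real.pi)| *
        (u ⬝ᵥ (axisMatrix n i (grunwaldMatrix (α i) (n i)) *ᵥ u) +
          v ⬝ᵥ (axisMatrix n i (grunwaldMatrix (α i) (n i)) *ᵥ v)) := by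
  have hni : (0 : ℝ) < n i := by exact_mod_cast hn i
  refine le_of_mul_le_mul_left ?_ hni
  rw [← abs_of_pos hni, ← abs_mul, abs_of_pos hni, mul_sub, mul_left_comm, mul_add]
  simp only [card_mul_axis_form]
  rw [← Finset.sum_sub_distrib, ← Finset.sum_add_distrib, Finset.mul_sum]
  refine (Finset.abs_sum_le_sum_abs _ _).trans (Finset.sum_le_sum fun x _ => ?_)
  exact grunwaldMatrix_skew_form_le (hα i).1 (hα i).2 _ _

/-- The mesh factor is common to both diffusion coefficients of an axis and cancels in their ratio,
which keeps `μ` independent of the grid. -/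
theorem scaledCoeff_eq (D α a b : ℝ) (m : ℕ) :
    scaledCoeff D α a b m = D * scaledCoeff 1 α a b m := by
  simp [scaledCoeff, div_eq_mul_inv]

theorem scaledCoeff_one_pos (α : ℝ) {a b : ℝ} (hab : a < b) (m : ℕ) :
    0 < scaledCoeff 1 α a b m := by
  have : 0 < (b - a) / ((m : ℝ) + 1) := div_pos (by linarith) (by positivity)
  rw [scaledCoeff]
  positivity

theorem le_asymmetry (i : Fin d) :
    |dp i - dm i| / (dp i + dm i) * |Real.tan (α i / 2 * Real.pi)| ≤ asymmetry α dp dm :=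
  le_ciSup (f := fun i => |dp i - dm i| / (dp i + dm i) * |Real.tan (α i / 2 * Real.pi)|)
    (Set.finite_range _).bddAbove i

theorem asymmetry_nonneg (hsum : ∀ i, 0 < dp i + dm i) : 0 ≤ asymmetry α dp dm :=
  Real.iSup_nonneg fun i =>
    mul_nonneg (div_nonneg (abs_nonneg _) (hsum i).le) (abs_nonneg _)

/-- Along axis `i` the skew part of `L` is weighted by `d_{i,+} - d_{i,-}` and the symmetric part by
`d_{i,+} + d_{i,-}`. The term `ν I` has no skew part and only enlarges the right side. -/
theorem systemMatrix_skew_form_le (hα : ∀ i, 1 < α i ∧ α i < 2) (hsum : ∀ i, 0 < dp i + dm i)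
    (hab : ∀ i, a i < b i) (hν : 0 ≤ ν) (hn : ∀ i, 1 ≤ n i) (u v : Grid n → ℝ) :
    |u ⬝ᵥ (systemMatrix ν α dp dm a b n *ᵥ v) - v ⬝ᵥ (systemMatrix ν α dp dm a b n *ᵥ u)| ≤
      asymmetry α dp dm * (u ⬝ᵥ (systemMatrix ν α dp dm a b n *ᵥ u) +
        v ⬝ᵥ (systemMatrix ν α dp dm a b n *ᵥ v)) := by
  simp only [systemMatrix_form]
  set μ := asymmetry α dp dm with hμ
  have hμ0 : 0 ≤ μ := asymmetry_nonneg hsum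
  set B : Fin d → (Grid n → ℝ) → (Grid n → ℝ) → ℝ := fun i u v =>
    u ⬝ᵥ (axisMatrix n i (grunwaldMatrix (α i) (n i)) *ᵥ v) with hB
  set c : Fin d → ℝ := fun i => scaledCoeff 1 (α i) (a i) (b i) (n i) with hc
  have hc0 : ∀ i, 0 < c i := fun i => scaledCoeff_one_pos _ (hab i) _
  have hBnn : ∀ i u, 0 ≤ B i u u := fun i u => by
    have := axis_tau_form_bounds hα hn i u
    exact le_trans (by linarith [this.1]) this.2.1
  have e1 : ν * (u ⬝ᵥ v) + ∑ i, (scaledCoeff (dp i) (α i) (a i) (b i) (n i) * B i u v +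
        scaledCoeff (dm i) (α i) (a i) (b i) (n i) * B i v u) -
      (ν * (v ⬝ᵥ u) + ∑ i, (scaledCoeff (dp i) (α i) (a i) (b i) (n i) * B i v u +
        scaledCoeff (dm i) (α i) (a i) (b i) (n i) * B i u v)) =
      ∑ i, c i * ((dp i - dm i) * (B i u v - B i v u)) := by
    rw [dotProduct_comm v u, add_sub_add_left_eq_sub, ← Finset.sum_sub_distrib]
    refine Finset.sum_congr rfl fun i _ => ?_
    rw [scaledCoeff_eq (dp i), scaledCoeff_eq (dm i)]
    ring
  have e2 : ∀ u, ν * (u ⬝ᵥ u) + ∑ i, (scaledCoeff (dp i) (α i) (a i) (b i) (n i) * B i u u +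
        scaledCoeff (dm i) (α i) (a i) (b i) (n i) * B i u u) =
      ν * (u ⬝ᵥ u) + ∑ i, c i * ((dp i + dm i) * B i u u) := by
    intro u
    congr 1
    refine Finset.sum_congr rfl fun i _ => ?_
    rw [scaledCoeff_eq (dp i), scaledCoeff_eq (dm i)]
    ring
  have hnn : ∀ u : Grid n → ℝ, 0 ≤ ν * (u ⬝ᵥ u) := fun u =>
    mul_nonneg hν (Finset.sum_nonneg fun x _ => mul_self_nonneg _)
  refine (le_of_eq (congrArg abs e1)).trans ((Finset.abs_sum_le_sum_abs _ _).trans ?_)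
  refine le_trans ?_ (le_of_eq (congrArg (μ * ·) (congrArg₂ (· + ·) (e2 u) (e2 v))).symm)
  have hmain : ∑ i, |c i * ((dp i - dm i) * (B i u v - B i v u))| ≤
      μ * (∑ i, c i * ((dp i + dm i) * B i u u) + ∑ i, c i * ((dp i + dm i) * B i v v)) := by
    rw [← Finset.sum_add_distrib, Finset.mul_sum]
    refine Finset.sum_le_sum fun i _ => ?_
    rw [abs_mul, abs_of_pos (hc0 i), ← mul_add, mul_left_comm, ← mul_add]
    refine mul_le_mul_of_nonneg_left ?_ (hc0 i).le
    have h1 := axis_skew_form_le hα hn i u v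
    have h2 := le_asymmetry (α := α) (dp := dp) (dm := dm) i
    rw [div_mul_eq_mul_div, div_le_iff₀ (hsum i)] at h2
    calc |(dp i - dm i) * (B i u v - B i v u)|
        ≤ |dp i - dm i| * (|Real.tan (α i / 2 * Real.pi)| * (B i u u + B i v v)) := by
          rw [abs_mul]
          exact mul_le_mul_of_nonneg_left h1 (abs_nonneg _)
      _ = (|dp i - dm i| * |Real.tan (α i / 2 * Real.pi)|) * (B i u u + B i v v) := by ring
      _ ≤ (μ * (dp i + dm i)) * (B i u u + B i v v) :=
          mul_le_mul_of_nonneg_right h2 (add_nonneg (hBnn i u) (hBnn i v))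
      _ = _ := by ring
  refine hmain.trans (mul_le_mul_of_nonneg_left ?_ hμ0)
  have := hnn u
  have := hnn v
  linarith

/-- The axis terms give weak inequalities; strictness comes from `ν ‖u‖² > 0`, which occurs with
factor `1` in both `A` and `P`. -/
theorem systemMatrix_form_bounds (hα : ∀ i, 1 < α i ∧ α i < 2) (hsum : ∀ i, 0 < dp i + dm i)
    (hab : ∀ i, a i < b i) (hν : 0 < ν) (hn : ∀ i, 1 ≤ n i) {u : Grid n → ℝ} (hu : u ≠ 0) :
    0 < u ⬝ᵥ (tauPreconditioner ν α dp dm a b n *ᵥ u) ∧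
    1 / 2 * (u ⬝ᵥ (tauPreconditioner ν α dp dm a b n *ᵥ u)) <
      u ⬝ᵥ (systemMatrix ν α dp dm a b n *ᵥ u) ∧
    u ⬝ᵥ (systemMatrix ν α dp dm a b n *ᵥ u) <
      3 / 2 * (u ⬝ᵥ (tauPreconditioner ν α dp dm a b n *ᵥ u)) := by
  rw [systemMatrix_form, tauPreconditioner_form]
  simp only [← add_mul]
  have hu0 : 0 < ν * (u ⬝ᵥ u) := mul_pos hν (by simpa using dotProduct_star_self_pos_iff.2 hu)
  have hs : ∀ i, 0 ≤ scaledCoeff (dp i) (α i) (a i) (b i) (n i) +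
      scaledCoeff (dm i) (α i) (a i) (b i) (n i) := by
    intro i
    rw [scaledCoeff_eq (dp i), scaledCoeff_eq (dm i), ← add_mul]
    exact mul_nonneg (hsum i).le (scaledCoeff_one_pos _ (hab i) _).le
  have h := axis_tau_form_bounds hα hn (α := α)
  have h1 := Finset.sum_nonneg fun i (_ : i ∈ Finset.univ) => mul_nonneg (hs i) (h i u).1
  have h2 := Finset.sum_le_sum fun i (_ : i ∈ Finset.univ) =>
    mul_le_mul_of_nonneg_left (h i u).2.1 (hs i)
  have h3 := Finset.sum_le_sum fun i (_ : i ∈ Finset.univ) =>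
    mul_le_mul_of_nonneg_left (h i u).2.2 (hs i)
  simp only [mul_left_comm _ (1 / 2 : ℝ), mul_left_comm _ (3 / 2 : ℝ), ← Finset.mul_sum] at h2 h3
  refine ⟨?_, ?_, ?_⟩ <;> linarith

theorem tauPreconditioner_posDef (hα : ∀ i, 1 < α i ∧ α i < 2) (hsum : ∀ i, 0 < dp i + dm i)
    (hab : ∀ i, a i < b i) (hν : 0 < ν) (hn : ∀ i, 1 ≤ n i) :
    (tauPreconditioner ν α dp dm a b n).PosDef := by
  refine Matrix.PosDef.of_dotProduct_mulVec_pos ?_ fun x hx => ?_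
  · rw [Matrix.IsHermitian, Matrix.conjTranspose_eq_transpose_of_trivial]
    exact tauPreconditioner_isSymm
  · simpa using (systemMatrix_form_bounds hα hsum hab hν hn hx).1

theorem system_eigenvalue_bounds (hα : ∀ i, 1 < α i ∧ α i < 2) (hsum : ∀ i, 0 < dp i + dm i)
    (hab : ∀ i, a i < b i) (hν : 0 < ν) (hn : ∀ i, 1 ≤ n i) {l : ℝ} {x : Grid n → ℝ}
    (hx : x ≠ 0) (hl : (multiAntiIdentity n * systemMatrix ν α dp dm a b n) *ᵥ x =
      l • (tauPreconditioner ν α dp dm a b n *ᵥ x)) :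
    1 / 2 < |l| ∧ |l| < 3 / 2 * √(1 + asymmetry α dp dm ^ 2) :=
  eigenvalue_bounds (asymmetry_nonneg hsum) (tauPreconditioner_posDef hα hsum hab hν hn)
    multiAntiIdentity_isSymm multiAntiIdentity_mul_self multiAntiIdentity_mul_tauPreconditioner
    (fun _ h => (systemMatrix_form_bounds hα hsum hab hν hn h).2.1)
    (fun _ h => (systemMatrix_form_bounds hα hsum hab hν hn h).2.2)
    (systemMatrix_skew_form_le hα hsum hab hν.le hn) hx hl

end System

/-! ### The rate `ω` and the constant `ε`. -/

section Rate

theorem rate_sq {ε : ℝ} (hε : 0 ≤ ε) : rate ε ^ 2 = (2 + 3 * ε) / (4 + 3 * ε) :=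
  Real.sq_sqrt (by positivity)

theorem sqrt_half_le_rate {ε : ℝ} (hε : 0 ≤ ε) : √(1 / 2) ≤ rate ε := by
  refine Real.sqrt_le_sqrt ?_
  rw [div_le_div_iff₀ (by norm_num) (by positivity)]
  linarith

theorem sqrt_half_lt_rate {ε : ℝ} (hε : 0 < ε) : √(1 / 2) < rate ε := by
  refine Real.sqrt_lt_sqrt (by norm_num) ?_
  rw [div_lt_div_iff₀ (by norm_num) (by positivity)]
  linarith

theorem rate_lt_one {ε : ℝ} (hε : 0 ≤ ε) : rate ε < 1 := by
  rw [rate, Real.sqrt_lt' one_pos, one_pow, div_lt_one (by positivity)]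
  linarith

theorem sqrt_one_add_sq_sub_one {μ : ℝ} (hμ : 0 ≤ μ) :
    (0 < √(1 + μ ^ 2) - 1 ∧ √(1 + μ ^ 2) - 1 < μ) ∨ (√(1 + μ ^ 2) - 1 = 0 ∧ μ = 0) := by
  rcases hμ.eq_or_lt with rfl | h
  · right; simp
  · left
    constructor
    · rw [sub_pos, Real.lt_sqrt (by norm_num)]
      nlinarith
    · rw [sub_lt_iff_lt_add, Real.sqrt_lt' (by positivity)]
      nlinarith

end Rate

end TauMinres

theorem mainTheorem2 (d : ℕ) (hd : 1 ≤ d) (α dp dm : Fin d → ℝ)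
    (hα : ∀ i, 1 < α i ∧ α i < 2) (hdp : ∀ i, 0 ≤ dp i) (hdm : ∀ i, 0 ≤ dm i)
    (hsum : ∀ i, 0 < dp i + dm i) :
    ∃ ε : ℝ,
      ((0 < ε ∧ ε < TauMinres.asymmetry α dp dm) ∨
        (ε = 0 ∧ TauMinres.asymmetry α dp dm = 0)) ∧
      √(1 / 2) ≤ TauMinres.rate ε ∧ TauMinres.rate ε < 1 ∧
      (0 < ε → √(1 / 2) < TauMinres.rate ε) ∧
      ∀ (a b : Fin d → ℝ) (_hab : ∀ i, a i < b i) (τ : ℝ) (_hτ : 0 < τ)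
        (n : Fin d → ℕ) (_hn : ∀ i, 1 ≤ n i)
        (A P Y : Matrix (TauMinres.Grid n) (TauMinres.Grid n) ℝ)
        (_hA : A = TauMinres.systemMatrix (1 / τ) α dp dm a b n)
        (_hP : P = TauMinres.tauPreconditioner (1 / τ) α dp dm a b n)
        (_hY : Y = TauMinres.multiAntiIdentity n),
        (Y * A).IsSymm ∧ P.PosDef ∧
        (∀ z ∈ spectrum ℂ ((P⁻¹ * (Y * A)).map (algebraMap ℝ ℂ)), ∃ x : ℝ, z = (x : ℂ) ∧
          x ∈ Set.Ioo (-(3 / 2 * (1 + ε))) (-(1 / 2)) ∪ Set.Ioo (1 / 2) (3 / 2 * (1 + ε))) ∧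
        ∀ (rhs u₀ u : TauMinres.Grid n → ℝ) (k : ℕ),
          TauMinres.IsMinresIterate (Y * A) P (Y *ᵥ rhs) u₀ k u →
          TauMinres.energyNorm P (TauMinres.precResidual (Y * A) P (Y *ᵥ rhs) u) ≤
            2 * TauMinres.rate ε ^ (2 * (k / 2)) *
              TauMinres.energyNorm P (TauMinres.precResidual (Y * A) P (Y *ᵥ rhs) u₀) := by
  have hε := TauMinres.sqrt_one_add_sq_sub_one (TauMinres.asymmetry_nonneg (α := α) hsum)
  have hb : √(1 + TauMinres.asymmetry α dp dm ^ 2) =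
      1 + (√(1 + TauMinres.asymmetry α dp dm ^ 2) - 1) := by ring
  have hbounds := @TauMinres.system_eigenvalue_bounds d
  generalize √(1 + TauMinres.asymmetry α dp dm ^ 2) - 1 = ε at hε hb
  have hε0 : 0 ≤ ε := hε.elim (fun h => h.1.le) fun h => h.1.ge
  refine ⟨ε, hε, TauMinres.sqrt_half_le_rate hε0, TauMinres.rate_lt_one hε0,
    TauMinres.sqrt_half_lt_rate, ?_⟩
  rintro a b hab τ hτ n hn A P Y rfl rfl rfl
  have hν : 0 < 1 / τ := by positivity
  have hS := TauMinres.multiAntiIdentity_mul_systemMatrix_isSymm (n := n) (ν := 1 / τ) (α := α)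
    (dp := dp) (dm := dm) (a := a) (b := b)
  have hP := TauMinres.tauPreconditioner_posDef hα hsum hab hν hn
  refine ⟨hS, hP, fun z hz => ?_, fun rhs u₀ u k hu => ?_⟩
  · obtain ⟨l, x, rfl, hx, hl⟩ := TauMinres.exists_real_eigenvector hS hP hz
    obtain ⟨h1, h2⟩ := hbounds hα hsum hab hν hn hx hl
    rw [hb] at h2
    refine ⟨l, rfl, ?_⟩
    rw [abs_lt] at h2
    rcases lt_abs.1 h1 with h | h
    · exact Or.inr ⟨h, h2.2⟩
    · exact Or.inl ⟨h2.1, by linarith⟩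
  · have h := TauMinres.energyNorm_minres_le hS hP hu (a := 1 / 2) (b := 3 / 2 * (1 + ε))
      (by norm_num) (by linarith) fun l x hx hl => by
        obtain ⟨h1, h2⟩ := hbounds hα hsum hab hν hn hx hl
        rw [hb] at h2
        exact ⟨h1.le, h2.le⟩
    -- The Chebyshev ratio `(b - a) / (b + a)` for `a = 1/2` and `b = 3/2 (1 + ε)` is exactly `ω²`.
    have e : (3 / 2 * (1 + ε) - 1 / 2) / (3 / 2 * (1 + ε) + 1 / 2) = TauMinres.rate ε ^ 2 := by
      rw [TauMinres.rate_sq hε0, div_eq_div_iff (by positivity) (by positivity)]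
      ring
    rwa [e, ← pow_mul] at h
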